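/- Let $\mathrm{Sym}^2(\mathbb R^n)$ be the space of symmetric real $n\times n$ matrices with inner product $\langle A,B\rangle=\mathrm{tr}(AB)$. Let $\mathcal P^+\subset \mathrm{Sym}^2(\mathbb R^n)$ be a closed convex cone with vertex at the origin, with polar cone $\mathcal P_+=\{A:\langle A,B\rangle\ge 0\ \text{for all } B\in\mathcal P^+\}$, and assume that every $A\in\mathcal P_+$ is positive semidefinite (this holds in particular if $\mathcal P^+$ is elliptic, i.e. if every $A$ in the relative interior of $\mathcal P_+$ is positive definite). For an open set $U\subset\mathbb R^n$ let $\mathrm{PSH}^\infty(U,\mathcal P^+)$ be the set of $u\in C^\infty(U)$ with $\mathrm{Hess}_x u\in\mathcal P^+$ for all $x\in U$; such a $u$ is strictly $\mathcal P^+$-plurisubharmonic if $\mathrm{Hess}_xu\in\mathrm{Int}\,\mathcal P^+$ for all $x\in U$. The hull of a compact set $K\subset U$ is $$\widehat K_U=\{x\in U : u(x)\le \sup_K u\ \text{ for all } u\in \mathrm{PSH}^\infty(U,\mathcal P^+)\},$$ with $\sup_\emptyset u=-\infty$. $K$ is called $\mathrm{PSH}^\infty(U,\mathcal P^+)$-convex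 if $\widehat K_U=K$. The open set $U$ is called $\mathcal P^+$-convex if $\widehat K_U$ is relatively compact in $U$ for every compact $K\subset U$ and $U$ admits a $C^\infty$ strictly $\mathcal P^+$-plurisubharmonic proper exhaustion function. (These two conditions are equivalent.) A linear subspace $W\subset\mathbb R^n$ is $\mathcal P_+$-free if $\mathcal P_+\cap \mathrm{Sym}^2(W)=\{0\}$, where $\mathrm{Sym}^2(W)\subset\mathrm{Sym}^2(\mathbb R^n)$ consists of the forms vanishing on $W^\perp$ (as matrices, those with $Av=0$ for all $v\in W^\perp$). A submanifold is $\mathcal P_+$-free if all its tangent spaces are. **Theorem.** Let $X\subset\mathbb R^n$ be open and let $M\subset X$ be a $\mathcal P_+$-free $C^\infty$ embedded submanifold without boundary that is closed as a subset of $X$. Then there is a fundamental neighborhood system $\mathcal F(M)$ of $M$ in $X$ (a family of open sets $U$ with $M\subset U\subset X$ such that every open set containing $M$ contains some $U\in\mathcal F(M)$) consisting of $\mathcal P^+$-convex open sets, each of which is connected if $M$ is connected. Moreover, for every $U\in\mathcal F(M)$: a) $M$ is a (strong) deformation retract of $U$; b) each compact subset $K\subset M$ is $\mathrm{PSH}^\infty(U,\mathcal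 P^+)$-convex. -/

import Mathlib

open Set Topology
open scoped ContDiff

/-- The space `Sym²(ℝⁿ)` of symmetric real `n × n` matrices (quadratic forms on `ℝⁿ`). -/
def SymForms (n : ℕ) : Submodule ℝ (Matrix (Fin n) (Fin n) ℝ) where
  carrier := {A | A.IsSymm}
  add_mem' := fun hA hB => Matrix.IsSymm.add hA hB
  zero_mem' := Matrix.isSymm_zero
  smul_mem' := fun c _ hA => Matrix.IsSymm.smul hA c

/-- The polar `𝒫₊ = {A : ⟨A, B⟩ = tr (A B) ≥ 0 for all B ∈ 𝒫⁺}` of the closed convex cone `𝒫⁺`. -/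
def polarCone {n : ℕ} (P : ProperCone ℝ (SymForms n)) : Set (SymForms n) :=
  {A | ∀ B ∈ P, 0 ≤ Matrix.trace (A.1 * B.1)}

/-- `𝒫⁺` is a positive cone: every `A ∈ 𝒫₊` is positive semidefinite.
For such a cone `𝒫⁺` contains all positive semidefinite forms, so it spans `Sym²(ℝⁿ)` and
its relative interior is its interior in `Sym²(ℝⁿ)`. -/
def IsPositiveCone {n : ℕ} (P : ProperCone ℝ (SymForms n)) : Prop :=
  ∀ A ∈ polarCone P, A.1.PosSemidef

/-- The matrix of second partial derivatives of `u` at `x`. -/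
noncomputable def hessMatrix {n : ℕ} (u : EuclideanSpace ℝ (Fin n) → ℝ)
    (x : EuclideanSpace ℝ (Fin n)) : Matrix (Fin n) (Fin n) ℝ :=
  Matrix.of fun i j =>
    fderiv ℝ (fderiv ℝ u) x (EuclideanSpace.single i 1) (EuclideanSpace.single j 1)

/-- `PSH^∞(U, 𝒫⁺)` for an open set `U`: the functions that are smooth on `U` and satisfy
`Hess_x u ∈ 𝒫⁺` for every `x ∈ U`. (Only the values on `U` matter.) -/
def PSHInfty {n : ℕ} (P : ProperCone ℝ (SymForms n)) (U : Set (EuclideanSpace ℝ (Fin n))) :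
    Set (EuclideanSpace ℝ (Fin n) → ℝ) :=
  {u | ContDiffOn ℝ ∞ u U ∧
    ∀ x ∈ U, hessMatrix u x ∈ (Subtype.val '' (P : Set (SymForms n)) : Set (Matrix _ _ ℝ))}

/-- `u` is smooth and strictly `𝒫⁺`-plurisubharmonic on the open set `U`:
`Hess_x u ∈ Int 𝒫⁺` for every `x ∈ U`. -/
def IsStrictPSH {n : ℕ} (P : ProperCone ℝ (SymForms n)) (U : Set (EuclideanSpace ℝ (Fin n)))
    (u : EuclideanSpace ℝ (Fin n) → ℝ) : Prop :=
  ContDiffOn ℝ ∞ u U ∧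
    ∀ x ∈ U,
      hessMatrix u x ∈ (Subtype.val '' interior (P : Set (SymForms n)) : Set (Matrix _ _ ℝ))

/-- The `PSH^∞(U)`-hull of `K`: the points `x ∈ U` with `u x ≤ sup_K u` for all
`u ∈ PSH^∞(U, 𝒫⁺)`. The inequality is written with upper bounds, so that the supremum over the
empty set is `-∞`. -/
def pshHull {n : ℕ} (P : ProperCone ℝ (SymForms n)) (U K : Set (EuclideanSpace ℝ (Fin n))) :
    Set (EuclideanSpace ℝ (Fin n)) :=
  {x ∈ U | ∀ u ∈ PSHInfty P U, ∀ c : ℝ, (∀ y ∈ K, u y ≤ c) → u x ≤ c}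

/-- The open set `U` is `𝒫⁺`-convex: hulls in `U` of compact subsets of `U` are relatively compact
in `U`, and `U` has a smooth strictly `𝒫⁺`-plurisubharmonic proper exhaustion function. (For a
positive cone these two conditions are equivalent; both are required here.) -/
structure IsPConvex {n : ℕ} (P : ProperCone ℝ (SymForms n))
    (U : Set (EuclideanSpace ℝ (Fin n))) : Prop where
  hull_relatively_compact : ∀ K ⊆ U, IsCompact K → ∃ L ⊆ U, IsCompact L ∧ pshHull P U K ⊆ L
  exists_exhaustion : ∃ u : EuclideanSpace ℝ (Fin n) → ℝ,
    IsStrictPSH P U u ∧ ∀ c : ℝ, IsCompact {x ∈ U | u x ≤ c}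

/-- `Sym²(W)` inside `Sym²(ℝⁿ)`: the forms that vanish on the orthogonal complement of `W`, i.e.
`A = (a 0; 0 0)` in terms of the decomposition `ℝⁿ = W ⊕ Wᗮ`. -/
def symFormsOn {n : ℕ} (W : Submodule ℝ (EuclideanSpace ℝ (Fin n))) : Set (SymForms n) :=
  {A | ∀ v ∈ Wᗮ, A.1.mulVec v.ofLp = 0}

/-- The linear subspace `W` is `𝒫₊`-free: `𝒫₊ ∩ Sym²(W) = {0}`. -/
def IsFreeSubspace {n : ℕ} (P : ProperCone ℝ (SymForms n))
    (W : Submodule ℝ (EuclideanSpace ℝ (Fin n))) : Prop :=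
  polarCone P ∩ symFormsOn W = {0}

/-- `M` is a smooth embedded submanifold of `ℝⁿ` (without boundary): near each of its points some
smooth local diffeomorphism of `ℝⁿ` carries it to a linear subspace. The dimension is locally
constant on `M`. -/
def IsEmbeddedSubmanifold {n : ℕ} (M : Set (EuclideanSpace ℝ (Fin n))) : Prop :=
  ∀ x ∈ M, ∃ (Φ : OpenPartialHomeomorph (EuclideanSpace ℝ (Fin n)) (EuclideanSpace ℝ (Fin n)))
    (V : Submodule ℝ (EuclideanSpace ℝ (Fin n))),
    x ∈ Φ.source ∧ ContDiffOn ℝ ∞ Φ Φ.source ∧ ContDiffOn ℝ ∞ Φ.symm Φ.target ∧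
      ∀ y ∈ Φ.source, y ∈ M ↔ Φ y ∈ V

/-- The tangent space of `M` at `x`: the velocities at `x` of the smooth curves in `M`. (For a
submanifold these already form a linear subspace, so that taking the span adds nothing.) -/
def tangentSubspace {n : ℕ} (M : Set (EuclideanSpace ℝ (Fin n)))
    (x : EuclideanSpace ℝ (Fin n)) : Submodule ℝ (EuclideanSpace ℝ (Fin n)) :=
  Submodule.span ℝ {v | ∃ γ : ℝ → EuclideanSpace ℝ (Fin n),
    ContDiffAt ℝ ∞ γ 0 ∧ γ 0 = x ∧ (∀ᶠ t in 𝓝 0, γ t ∈ M) ∧ HasDerivAt γ v 0}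

/-- `M` is a closed submanifold of the open set `X`: an embedded submanifold contained in `X` that
is closed relative to `X`. -/
structure IsClosedSubmanifold {n : ℕ} (X M : Set (EuclideanSpace ℝ (Fin n))) : Prop where
  subset : M ⊆ X
  closed : closure M ∩ X ⊆ M
  embedded : IsEmbeddedSubmanifold M

/-- The submanifold `M` is `𝒫₊`-free: all its tangent spaces are. -/
def IsFreeSubmanifold {n : ℕ} (P : ProperCone ℝ (SymForms n))
    (M : Set (EuclideanSpace ℝ (Fin n))) : Prop :=
  ∀ x ∈ M, IsFreeSubspace P (tangentSubspace M x)

/-- `M` is a (strong) deformation retract of `U`: the identity of `U` is homotopic, through maps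
`U → U` fixing `M` pointwise, to a retraction of `U` onto `M`. -/
def IsDeformationRetract {E : Type*} [TopologicalSpace E] (M U : Set E) : Prop :=
  M ⊆ U ∧ ∃ H : ℝ × E → E,
    ContinuousOn H (Icc 0 1 ×ˢ U) ∧ MapsTo H (Icc 0 1 ×ˢ U) U ∧
      (∀ x ∈ U, H (0, x) = x) ∧ (∀ x ∈ U, H (1, x) ∈ M) ∧
      ∀ t ∈ Icc (0 : ℝ) 1, ∀ x ∈ M, H (t, x) = x

/-- `ℱ` is a fundamental neighborhood system of `M` in `X`, consisting of open sets. -/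
structure IsFundamentalNhdSystem {E : Type*} [TopologicalSpace E] (X M : Set E)
    (F : Set (Set E)) : Prop where
  isOpen : ∀ U ∈ F, IsOpen U
  subset : ∀ U ∈ F, M ⊆ U ∧ U ⊆ X
  exists_subset : ∀ V : Set E, IsOpen V → M ⊆ V → ∃ U ∈ F, U ⊆ V

/-!
The submanifold `M` is the zero set of a smooth function `f` on `X` that dominates the squared
distance to `M` (`IsClosedSubmanifold.exists_sq_infDist_le`). At a point of `M` the Hessian of such
an `f` is positive semidefinite, and its null vectors are tangent to `M`, because the distance to
`M` along a null direction is `o(t)`. An element `A` of the polar cone is a sum of rank one forms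
`cₖ cₖᵀ`; if its pairing with the Hessian vanishes, then all `cₖ` are tangent to `M`, and freeness
gives `A = 0`. Hence the Hessian of `f` is positive on the nonzero elements of the polar cone
(`isPolarPos_fderiv_fderiv`). As the cone is positive, its polar has a compact base, so this
positivity is an open condition, and by the bipolar theorem it places the Hessian in the interior of
the cone (`IsPolarPos.eventually`, `IsPolarPos.formMatrix_mem`).

Multiplying `f` by a large function makes the Hessian of `h + f` positive on `M` as well, where `h`
is a fixed smooth exhaustion of `X` (`IsClosedSubmanifold.exists_defining_function`). The
neighborhoods are `U = {f < η ^ 2}`, where `η` is a positive function that is small together with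
its first and second derivatives (`exists_contDiff_pos_le`, `IsClosedSubmanifold.exists_radius`).

* `U` is convex with respect to the cone, since `h + f + (η ^ 2 - f)⁻¹` is a strictly
  plurisubharmonic exhaustion: `-1 / s` is increasing and convex on `s < 0`, and `f - η ^ 2` is
  plurisubharmonic for small `η` (`isPolarNonneg_fderiv_fderiv_inv`, `isPConvex_of_exhaustion`).
* Moving points along segments to their nearest points in `M` retracts `U` to `M`: near `M` the
  function `f` is convex on these segments, so that it decreases at least linearly, faster than
  `η ^ 2` can (`IsClosedSubmanifold.eventually_forall_segment`, `isDeformationRetract_of_segment`).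
* For compact `K ⊆ M`, the function `f` excludes the points off `M` from the hull, and `f + s g`
  excludes a point of `M` off `K`, where `g` is a bump function at this point supported off `K` and
  `s > 0` is small (`pshHull_eq_of_subset`).
-/

open Filter

/-! ### Forms that are positive on the polar cone -/

/-- The Gram matrix of a bilinear form in the standard basis. -/
noncomputable def formMatrix {n : ℕ}
    (L : EuclideanSpace ℝ (Fin n) →L[ℝ] EuclideanSpace ℝ (Fin n) →L[ℝ] ℝ) :
    Matrix (Fin n) (Fin n) ℝ :=
  Matrix.of fun i j => L (EuclideanSpace.single i 1) (EuclideanSpace.single j 1)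

/-- The trace pairing `⟨A, L⟩` of a symmetric matrix with a bilinear form. -/
noncomputable def formPairing {n : ℕ} (A : SymForms n)
    (L : EuclideanSpace ℝ (Fin n) →L[ℝ] EuclideanSpace ℝ (Fin n) →L[ℝ] ℝ) : ℝ :=
  Matrix.trace (A.1 * formMatrix L)

/-- Nonnegativity of a bilinear form on the polar cone. For symmetric forms this is membership in
the cone itself, by the bipolar theorem. -/
def IsPolarNonneg {n : ℕ} (P : ProperCone ℝ (SymForms n))
    (L : EuclideanSpace ℝ (Fin n) →L[ℝ] EuclideanSpace ℝ (Fin n) →L[ℝ] ℝ) : Prop :=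
  ∀ A ∈ polarCone P, 0 ≤ formPairing A L

/-- Positivity of a bilinear form on the nonzero elements of the polar cone. For symmetric forms and
a positive cone this characterizes the interior of the cone. -/
def IsPolarPos {n : ℕ} (P : ProperCone ℝ (SymForms n))
    (L : EuclideanSpace ℝ (Fin n) →L[ℝ] EuclideanSpace ℝ (Fin n) →L[ℝ] ℝ) : Prop :=
  ∀ A ∈ polarCone P, A ≠ 0 → 0 < formPairing A L

section Pairing

variable {n : ℕ}

local notation "𝔼" n:max => EuclideanSpace ℝ (Fin n)

theorem formPairing_eq_sum (A : SymForms n) (L : 𝔼 n →L[ℝ] 𝔼 n →L[ℝ] ℝ) :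
    formPairing A L = ∑ i, ∑ j, A.1 i j *
      L (EuclideanSpace.single j 1) (EuclideanSpace.single i 1) := by
  simp [formPairing, Matrix.trace, Matrix.mul_apply, formMatrix]

theorem formPairing_add (A : SymForms n) (L L' : 𝔼 n →L[ℝ] 𝔼 n →L[ℝ] ℝ) :
    formPairing A (L + L') = formPairing A L + formPairing A L' := by
  simp [formPairing_eq_sum, mul_add, Finset.sum_add_distrib]

theorem formPairing_smul (A : SymForms n) (c : ℝ) (L : 𝔼 n →L[ℝ] 𝔼 n →L[ℝ] ℝ) :
    formPairing A (c • L) = c * formPairing A L := by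
  simp [formPairing_eq_sum, Finset.mul_sum, mul_left_comm]

theorem continuous_formMatrix :
    Continuous (formMatrix : (𝔼 n →L[ℝ] 𝔼 n →L[ℝ] ℝ) → Matrix (Fin n) (Fin n) ℝ) := by
  unfold formMatrix
  refine continuous_matrix fun i j => ?_
  simp only [Matrix.of_apply]
  fun_prop

theorem IsPolarPos.isPolarNonneg {P : ProperCone ℝ (SymForms n)} {L : 𝔼 n →L[ℝ] 𝔼 n →L[ℝ] ℝ}
    (h : IsPolarPos P L) : IsPolarNonneg P L := by
  intro A hA
  by_cases h0 : A = 0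
  · simp [h0, formPairing]
  · exact (h A hA h0).le

theorem IsPolarPos.add_nonneg {P : ProperCone ℝ (SymForms n)} {L L' : 𝔼 n →L[ℝ] 𝔼 n →L[ℝ] ℝ}
    (h : IsPolarPos P L) (h' : IsPolarNonneg P L') : IsPolarPos P (L + L') := by
  intro A hA h0
  rw [formPairing_add]
  exact add_pos_of_pos_of_nonneg (h A hA h0) (h' A hA)

theorem IsPolarNonneg.add {P : ProperCone ℝ (SymForms n)} {L L' : 𝔼 n →L[ℝ] 𝔼 n →L[ℝ] ℝ}
    (h : IsPolarNonneg P L) (h' : IsPolarNonneg P L') : IsPolarNonneg P (L + L') := by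
  intro A hA
  rw [formPairing_add]
  exact _root_.add_nonneg (h A hA) (h' A hA)

theorem IsPolarNonneg.smul {P : ProperCone ℝ (SymForms n)} {L : 𝔼 n →L[ℝ] 𝔼 n →L[ℝ] ℝ}
    (h : IsPolarNonneg P L) {c : ℝ} (hc : 0 ≤ c) : IsPolarNonneg P (c • L) := by
  intro A hA
  rw [formPairing_smul]
  exact mul_nonneg hc (h A hA)

/-- A positive semidefinite matrix is a sum of rank one matrices `cₖ cₖᵀ`. -/
theorem exists_formPairing_eq_sum_apply {A : SymForms n} (hA : A.1.PosSemidef) :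
    ∃ c : Fin n → 𝔼 n, (∀ i j, A.1 i j = ∑ k, c k i * c k j) ∧
      ∀ L : 𝔼 n →L[ℝ] 𝔼 n →L[ℝ] ℝ, formPairing A L = ∑ k, L (c k) (c k) := by
  obtain ⟨C, hC⟩ : ∃ C : Matrix (Fin n) (Fin n) ℝ, A.1 = C.conjTranspose * C := by
    open scoped MatrixOrder in
    exact CStarAlgebra.nonneg_iff_eq_star_mul_self.1 hA.nonneg
  have hAC : ∀ i j, A.1 i j = ∑ k, C k i * C k j := by
    intro i j
    rw [hC]
    simp [Matrix.mul_apply]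
  refine ⟨fun k => WithLp.toLp 2 (C k), hAC, fun L => ?_⟩
  have hexp : ∀ v : 𝔼 n, v = ∑ i, v i • EuclideanSpace.single i (1 : ℝ) := by
    intro v
    ext j
    simp [Pi.single_apply]
  have key : ∀ v : 𝔼 n, L v v = ∑ i, ∑ j, v i * v j *
      L (EuclideanSpace.single j 1) (EuclideanSpace.single i 1) := by
    intro v
    conv_lhs => rw [hexp v]
    simp only [map_sum, map_smul, sum_apply, smul_apply,
      smul_eq_mul, Finset.mul_sum]
    refine Finset.sum_congr rfl fun i _ => Finset.sum_congr rfl fun j _ => by ring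
  rw [formPairing_eq_sum]
  simp_rw [key, hAC, Finset.sum_mul]
  calc _ = ∑ i, ∑ k, ∑ j, C k i * C k j *
        L (EuclideanSpace.single j 1) (EuclideanSpace.single i 1) :=
        Finset.sum_congr rfl fun i _ => Finset.sum_comm
    _ = _ := Finset.sum_comm

/-- Positive semidefinite matrices of trace one have entries bounded by one, which makes the
section `tr A = 1` of the polar cone compact. -/
theorem isCompact_polarCone_trace_eq_one {P : ProperCone ℝ (SymForms n)} (hP : IsPositiveCone P) :
    IsCompact (Subtype.val '' (polarCone P ∩ {A | A.1.trace = 1}) :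
      Set (Matrix (Fin n) (Fin n) ℝ)) := by
  have hbox : IsCompact {A : Matrix (Fin n) (Fin n) ℝ | ∀ i j, A i j ∈ Icc (-1 : ℝ) 1} := by
    have : IsCompact (univ.pi fun _ : Fin n => univ.pi fun _ : Fin n => Icc (-1 : ℝ) 1) :=
      isCompact_univ_pi fun _ => isCompact_univ_pi fun _ => isCompact_Icc
    convert! this using 1
    ext A
    constructor
    · exact fun h i _ j _ => h i j
    · exact fun h i j => h i trivial j trivial
  refine hbox.of_isClosed_subset ?_ ?_
  · have : (Subtype.val '' (polarCone P ∩ {A | A.1.trace = 1}) : Set (Matrix (Fin n) (Fin n) ℝ))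
        = {A | A.transpose = A} ∩ (⋂ B ∈ P, {A | 0 ≤ (A * B.1).trace}) ∩ {A | A.trace = 1} := by
      ext A
      simp only [mem_image, mem_inter_iff, polarCone, mem_ofPred_eq, mem_iInter]
      constructor
      · rintro ⟨A, ⟨h1, h2⟩, rfl⟩
        exact ⟨⟨A.2, h1⟩, h2⟩
      · rintro ⟨⟨h0, h1⟩, h2⟩
        exact ⟨⟨A, h0⟩, ⟨h1, h2⟩, rfl⟩
    rw [this]
    refine ((isClosed_eq (by fun_prop) (by fun_prop)).inter (isClosed_biInter fun B _ =>
      isClosed_le (by fun_prop) (by fun_prop))).inter (isClosed_eq (by fun_prop) (by fun_prop))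
  · rintro _ ⟨A, ⟨hA, hA1⟩, rfl⟩ i j
    obtain ⟨c, hAc, -⟩ := exists_formPairing_eq_sum_apply (hP A hA)
    have htr : ∑ i, ∑ k, c k i ^ 2 = 1 := by
      rw [← (show A.1.trace = 1 from hA1), Matrix.trace]
      simp [hAc, sq]
    have hle : ∀ i, ∑ k, c k i ^ 2 ≤ 1 := fun i =>
      htr ▸ Finset.single_le_sum (f := fun i => ∑ k, c k i ^ 2)
        (fun i _ => Finset.sum_nonneg fun k _ => sq_nonneg _) (Finset.mem_univ i)
    have h1 : ∑ k, c k i * c k j ≤ ∑ k, (c k i ^ 2 + c k j ^ 2) / 2 :=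
      Finset.sum_le_sum fun k _ => by nlinarith [sq_nonneg (c k i - c k j)]
    have h2 : -∑ k, (c k i ^ 2 + c k j ^ 2) / 2 ≤ ∑ k, c k i * c k j := by
      rw [← Finset.sum_neg_distrib]
      exact Finset.sum_le_sum fun k _ => by nlinarith [sq_nonneg (c k i + c k j)]
    rw [← Finset.sum_div, Finset.sum_add_distrib] at h1 h2
    rw [hAc, mem_Icc]
    constructor <;> linarith [hle i, hle j]

theorem trace_pos_of_mem_polarCone {P : ProperCone ℝ (SymForms n)} (hP : IsPositiveCone P)
    {A : SymForms n} (hA : A ∈ polarCone P) (h0 : A ≠ 0) : 0 < A.1.trace := by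
  refine lt_of_le_of_ne (hP A hA).trace_nonneg fun h => h0 (Subtype.ext ?_)
  obtain ⟨c, hAc, -⟩ := exists_formPairing_eq_sum_apply (hP A hA)
  have h2 : ∑ k, ∑ i, c k i * c k i = 0 := by
    rw [Finset.sum_comm, h, Matrix.trace]
    simp [hAc]
  have hc : ∀ k i, c k i = 0 := by
    intro k i
    have h3 := (Finset.sum_eq_zero_iff_of_nonneg fun k _ =>
      Finset.sum_nonneg fun i _ => mul_self_nonneg (c k i)).1 h2 k (Finset.mem_univ k)
    have h4 := (Finset.sum_eq_zero_iff_of_nonneg fun i _ =>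
      mul_self_nonneg (c k i)).1 h3 i (Finset.mem_univ i)
    exact mul_self_eq_zero.1 h4
  ext i j
  simp [hAc, hc]

theorem eventually_forall_trace_pos {P : ProperCone ℝ (SymForms n)} (hP : IsPositiveCone P)
    {T : Type*} [TopologicalSpace T] {F : T → Matrix (Fin n) (Fin n) ℝ} (hF : Continuous F)
    {t₀ : T} (h : ∀ A ∈ polarCone P, A ≠ 0 → 0 < (A.1 * F t₀).trace) :
    ∀ᶠ t in 𝓝 t₀, ∀ A ∈ polarCone P, A ≠ 0 → 0 < (A.1 * F t).trace := by
  have h1 := (isCompact_polarCone_trace_eq_one hP).eventually_forall_of_forall_eventually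
    (x₀ := t₀) (P := fun t A => 0 < (A * F t).trace) ?_
  · filter_upwards [h1] with t ht A hA h0
    have htr := trace_pos_of_mem_polarCone hP hA h0
    have := ht ((A.1.trace)⁻¹ • A.1) ⟨(A.1.trace)⁻¹ • A, ⟨?_, ?_⟩, rfl⟩
    · simp only [Matrix.smul_mul, Matrix.trace_smul, smul_eq_mul] at this
      exact (mul_pos_iff_of_pos_left (inv_pos.2 htr)).1 this
    · intro B hB
      simp only [Submodule.coe_smul, Matrix.smul_mul, Matrix.trace_smul, smul_eq_mul]
      exact mul_nonneg (inv_pos.2 htr).le (hA B hB)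
    · simp only [mem_ofPred_eq, Submodule.coe_smul, Matrix.trace_smul, smul_eq_mul]
      exact inv_mul_cancel₀ htr.ne'
  · rintro _ ⟨A, ⟨hA, hA1⟩, rfl⟩
    have hA0 : A ≠ 0 := by
      rintro rfl
      simp at hA1
    have hc : Continuous fun z : T × Matrix (Fin n) (Fin n) ℝ => (z.2 * F z.1).trace := by
      fun_prop
    exact (hc.tendsto (t₀, A.1)).eventually (lt_mem_nhds (h A hA hA0))

theorem IsPolarPos.eventually {P : ProperCone ℝ (SymForms n)} (hP : IsPositiveCone P)
    {L : 𝔼 n →L[ℝ] 𝔼 n →L[ℝ] ℝ} (h : IsPolarPos P L) : ∀ᶠ L' in 𝓝 L, IsPolarPos P L' :=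
  eventually_forall_trace_pos hP continuous_formMatrix h

/-- Continuous linear functionals on symmetric matrices are traces against symmetric matrices. -/
theorem exists_trace_mul_eq (l : SymForms n →ₗ[ℝ] ℝ) :
    ∃ A : SymForms n, ∀ B : SymForms n, (A.1 * B.1).trace = l B := by
  have hs : ∀ i j : Fin n,
      (Matrix.single i j (1 / 2 : ℝ) + Matrix.single j i (1 / 2 : ℝ)) ∈ SymForms n := by
    intro i j
    change Matrix.transpose _ = _
    simp [Matrix.transpose_add, Matrix.transpose_single, add_comm]
  refine ⟨⟨Matrix.of fun i j => l ⟨_, hs i j⟩, ?_⟩, fun B => ?_⟩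
  · ext i j
    simp only [Matrix.transpose_apply, Matrix.of_apply]
    congr 2
    exact add_comm _ _
  · have hB : B = ∑ i, ∑ j, B.1 j i • (⟨_, hs i j⟩ : SymForms n) := by
      have hBs : ∀ i j, B.1 i j = B.1 j i := fun i j => congrFun (congrFun B.2 j) i
      ext a b
      simp only [AddSubmonoidClass.coe_finsetSum, Submodule.coe_smul, Matrix.sum_apply,
        Matrix.smul_apply, Matrix.add_apply, smul_eq_mul]
      simp [Matrix.single_apply, mul_add, Finset.sum_add_distrib, ite_and, hBs a b]
      ring
    conv_rhs => rw [hB]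
    simp only [map_sum, map_smul, smul_eq_mul, Matrix.trace, Matrix.mul_apply, Matrix.diag_apply,
      Matrix.of_apply, mul_comm]

/-- The bipolar theorem for the trace pairing. -/
theorem mem_of_forall_trace_nonneg {P : ProperCone ℝ (SymForms n)} {B : SymForms n}
    (h : ∀ A ∈ polarCone P, 0 ≤ (A.1 * B.1).trace) : B ∈ P := by
  by_contra hB
  have : LocallyConvexSpace ℝ (Matrix (Fin n) (Fin n) ℝ) :=
    inferInstanceAs (LocallyConvexSpace ℝ (Fin n → Fin n → ℝ))
  have : LocallyConvexSpace ℝ (SymForms n) :=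
    LocallyConvexSpace.induced (SymForms n).subtype
  obtain ⟨l, hl, hlB⟩ := P.hyperplane_separation_point hB
  obtain ⟨A, hA⟩ := exists_trace_mul_eq (l : SymForms n →ₗ[ℝ] ℝ)
  have := h A fun C hC => (hA C).symm ▸ hl C hC
  rw [hA] at this
  exact absurd hlB (not_lt.2 this)

theorem isSymm_formMatrix {L : 𝔼 n →L[ℝ] 𝔼 n →L[ℝ] ℝ} (hL : ∀ v w, L v w = L w v) :
    formMatrix L ∈ SymForms n := by
  ext i j
  simp [formMatrix, hL]

theorem IsPolarNonneg.formMatrix_mem {P : ProperCone ℝ (SymForms n)} {L : 𝔼 n →L[ℝ] 𝔼 n →L[ℝ] ℝ}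
    (h : IsPolarNonneg P L) (hL : ∀ v w, L v w = L w v) :
    formMatrix L ∈ (Subtype.val '' (P : Set (SymForms n)) : Set (Matrix _ _ ℝ)) :=
  ⟨⟨formMatrix L, isSymm_formMatrix hL⟩, mem_of_forall_trace_nonneg h, rfl⟩

theorem IsPolarPos.formMatrix_mem {P : ProperCone ℝ (SymForms n)} (hP : IsPositiveCone P)
    {L : 𝔼 n →L[ℝ] 𝔼 n →L[ℝ] ℝ} (h : IsPolarPos P L) (hL : ∀ v w, L v w = L w v) :
    formMatrix L ∈ (Subtype.val '' interior (P : Set (SymForms n)) : Set (Matrix _ _ ℝ)) := by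
  refine ⟨⟨formMatrix L, isSymm_formMatrix hL⟩, ?_, rfl⟩
  rw [mem_interior_iff_mem_nhds]
  have := eventually_forall_trace_pos hP (F := fun B : SymForms n => B.1) continuous_subtype_val
    (t₀ := ⟨formMatrix L, isSymm_formMatrix hL⟩) h
  filter_upwards [this] with B hB
  refine mem_of_forall_trace_nonneg fun A hA => ?_
  by_cases h0 : A = 0
  · simp [h0]
  · exact (hB A hA h0).le

theorem isPolarNonneg_of_nonneg {P : ProperCone ℝ (SymForms n)} (hP : IsPositiveCone P)
    {L : 𝔼 n →L[ℝ] 𝔼 n →L[ℝ] ℝ} (h : ∀ v, 0 ≤ L v v) : IsPolarNonneg P L := by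
  intro A hA
  obtain ⟨c, -, hc⟩ := exists_formPairing_eq_sum_apply (hP A hA)
  rw [hc]
  exact Finset.sum_nonneg fun k _ => h _

/-- A positive semidefinite form whose null vectors lie in a free subspace `W` is positive on the
polar cone: if `⟨A, L⟩ = 0` for `A = ∑ cₖ cₖᵀ`, then every `cₖ` is a null vector of `L`, so that `A`
is a form on `W`. -/
theorem isPolarPos_of_free {P : ProperCone ℝ (SymForms n)} (hP : IsPositiveCone P)
    {W : Submodule ℝ (𝔼 n)} (hW : IsFreeSubspace P W) {L : 𝔼 n →L[ℝ] 𝔼 n →L[ℝ] ℝ}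
    (h : ∀ v, 0 ≤ L v v) (hker : ∀ v, L v v = 0 → v ∈ W) : IsPolarPos P L := by
  intro A hA h0
  refine lt_of_le_of_ne (isPolarNonneg_of_nonneg hP h A hA) fun heq => h0 ?_
  obtain ⟨c, hAc, hc⟩ := exists_formPairing_eq_sum_apply (hP A hA)
  rw [hc, eq_comm, Finset.sum_eq_zero_iff_of_nonneg fun k _ => h _] at heq
  have hcW : ∀ k, c k ∈ W := fun k => hker _ (heq k (Finset.mem_univ _))
  have : A ∈ polarCone P ∩ symFormsOn W := by
    refine ⟨hA, fun v hv => ?_⟩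
    have hcv : ∀ k, ∑ j, c k j * v j = 0 := by
      intro k
      have := hv (c k) (hcW k)
      rw [PiLp.inner_apply] at this
      simpa [mul_comm] using this
    ext i
    simp only [Matrix.mulVec, dotProduct, hAc, Finset.sum_mul, Pi.zero_apply]
    rw [Finset.sum_comm]
    refine Finset.sum_eq_zero fun k _ => ?_
    simp_rw [mul_assoc]
    rw [← Finset.mul_sum, hcv, mul_zero]
  rw [hW] at this
  exact this

end Pairing

/-! ### Smooth functions on open sets with pointwise constraints -/

section SmoothFunctions

variable {E : Type*} [NormedAddCommGroup E] [NormedSpace ℝ E] [FiniteDimensional ℝ E]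

open scoped Manifold in
/-- A partition of unity argument on an open subset `X`: if the convex constraints `g x ∈ t x` have
smooth local solutions near each point of `X`, they have a smooth solution on `X`. -/
theorem exists_contDiffOn_forall_mem_convex {X : Set E} (hX : IsOpen X) {t : E → Set ℝ}
    (ht : ∀ x ∈ X, Convex ℝ (t x))
    (hloc : ∀ p ∈ X, ∃ g : E → ℝ, ∃ u ∈ 𝓝 p, ContDiffOn ℝ ∞ g u ∧ ∀ x ∈ u, x ∈ X → g x ∈ t x) :
    ∃ g : E → ℝ, ContDiffOn ℝ ∞ g X ∧ ∀ x ∈ X, g x ∈ t x := by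
  classical
  let O : TopologicalSpace.Opens E := ⟨X, hX⟩
  have : LocallyCompactSpace O := hX.locallyCompactSpace
  obtain ⟨g, hg⟩ := exists_contMDiffMap_forall_mem_convex_of_local (n := ⊤) 𝓘(ℝ, E) (M := O)
    (F := ℝ) (t := fun x => t x.1) (fun x => ht x.1 x.2) (fun x => by
      obtain ⟨g, u, hu, hg, hgt⟩ := hloc x.1 x.2
      refine ⟨_, preimage_coe_mem_nhds_subtype.2 (mem_nhdsWithin_of_mem_nhds hu), fun y => g y,
        ?_, fun y hy => hgt y.1 hy y.2⟩
      exact hg.contMDiffOn.comp contMDiff_subtype_val.contMDiffOn fun y hy => hy)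
  refine ⟨fun x => if hx : x ∈ X then g ⟨x, hx⟩ else 0, ?_, fun x hx => ?_⟩
  · intro x hx
    have h1 := (contMDiffAt_subtype_iff (U := O) (f := fun x => if hx : x ∈ X then g ⟨x, hx⟩ else 0)
      (x := ⟨x, hx⟩) (I := 𝓘(ℝ, E)) (I' := 𝓘(ℝ, ℝ)) (n := ∞)).1 ?_
    · exact (contMDiffAt_iff_contDiffAt.1 h1).contDiffWithinAt
    · convert! g.contMDiff.contMDiffAt (x := ⟨x, hx⟩) using 1
      funext y
      exact dif_pos y.2
  · simp only [hx, dif_pos]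
    exact hg ⟨x, hx⟩

/-- Constraints of the form "all sufficiently small positive numbers" have a positive smooth
solution. -/
theorem exists_contDiffOn_pos_of_eventually {X : Set E} (hX : IsOpen X) {Q : E → ℝ → Prop}
    (hQ : ∀ p ∈ X, ∃ s > 0, ∀ᶠ x in 𝓝 p, ∀ s', 0 < s' → s' ≤ s → Q x s') :
    ∃ δ : E → ℝ, ContDiffOn ℝ ∞ δ X ∧ ∀ x ∈ X, 0 < δ x ∧ Q x (δ x) := by
  have hconv : ∀ x ∈ X, Convex ℝ {s | 0 < s ∧ ∀ s', 0 < s' → s' ≤ s → Q x s'} := by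
    intro x _
    refine OrdConnected.convex ⟨fun a ha b hb c hc => ⟨ha.1.trans_le hc.1, fun s' h0 hs' => ?_⟩⟩
    exact hb.2 s' h0 (hs'.trans hc.2)
  obtain ⟨δ, hδ, h⟩ := exists_contDiffOn_forall_mem_convex hX hconv fun p hp => by
    obtain ⟨s, hs, hsQ⟩ := hQ p hp
    exact ⟨fun _ => s, _, hsQ, contDiffOn_const, fun x hx _ => ⟨hs, hx⟩⟩
  exact ⟨δ, hδ, fun x hx => ⟨(h x hx).1, (h x hx).2 _ (h x hx).1 le_rfl⟩⟩

open Function in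
/-- On an open set `X` there are positive smooth functions, extending smoothly by zero to the whole
space, that are arbitrarily small together with their first and second derivatives: a sum of bump
functions with coefficients tending to zero quickly enough. -/
theorem exists_contDiff_pos_le {X : Set E} (hX : IsOpen X) {δ : E → ℝ} (hδ : ContinuousOn δ X)
    (hpos : ∀ x ∈ X, 0 < δ x) :
    ∃ η : E → ℝ, ContDiff ℝ ∞ η ∧ (∀ x ∉ X, η x = 0) ∧ ∀ x ∈ X, 0 < η x ∧ η x ≤ δ x ∧
      ‖fderiv ℝ η x‖ ≤ δ x ∧ ‖fderiv ℝ (fderiv ℝ η) x‖ ≤ δ x := by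
  rcases eq_empty_or_nonempty X with (rfl | h's)
  · exact ⟨fun _ => 0, contDiff_const, by simp, by simp⟩
  let ι := { f : E → ℝ // tsupport f ⊆ X ∧ HasCompactSupport f ∧ ContDiff ℝ ∞ f ∧ ∀ x, 0 ≤ f x }
  obtain ⟨T, T_count, hT⟩ : ∃ T : Set ι, T.Countable ∧ ⋃ f ∈ T, support (f : E → ℝ) = X := by
    have : ⋃ f : ι, (f : E → ℝ).support = X := by
      refine Subset.antisymm (iUnion_subset fun f => (subset_tsupport _).trans f.2.1) ?_
      intro x hx
      rcases exists_contDiff_tsupport_subset (n := ⊤) (hX.mem_nhds hx) with ⟨f, hf⟩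
      let g : ι := ⟨f, hf.1, hf.2.1, hf.2.2.1, fun x => (hf.2.2.2.1 (mem_range_self x)).1⟩
      have : x ∈ support (g : E → ℝ) := by
        simp only [g, hf.2.2.2.2, mem_support, Ne, one_ne_zero, not_false_iff]
      exact mem_iUnion_of_mem _ this
    simp_rw [← this]
    apply TopologicalSpace.isOpen_iUnion_countable
    rintro ⟨f, hf⟩
    exact hf.2.2.1.continuous.isOpen_support
  obtain ⟨g0, hg⟩ : ∃ g0 : ℕ → ι, T = range g0 := by
    apply Countable.exists_eq_range T_count
    rcases eq_empty_or_nonempty T with (rfl | hT)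
    · simp only [← hT, mem_empty_iff_false, iUnion_of_empty, iUnion_empty, Set.not_nonempty_empty]
        at h's
    · exact hT
  let g : ℕ → E → ℝ := fun n => (g0 n).1
  have g_s : ∀ n, tsupport (g n) ⊆ X := fun n => (g0 n).2.1
  have s_g : ∀ x ∈ X, ∃ n, g n x ≠ 0 := fun x hx ↦ by
    rw [← hT] at hx
    obtain ⟨i, iT, hi⟩ : ∃ i ∈ T, x ∈ support (i : E → ℝ) := by
      simpa only [mem_iUnion, exists_prop] using! hx
    obtain ⟨n, rfl⟩ := hg ▸ iT
    exact ⟨n, hi⟩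
  have g_smooth : ∀ n, ContDiff ℝ ∞ (g n) := fun n => (g0 n).2.2.2.1
  have g_comp_supp : ∀ n, HasCompactSupport (g n) := fun n => (g0 n).2.2.1
  have g_nonneg : ∀ n x, 0 ≤ g n x := fun n x => (g0 n).2.2.2.2 x
  obtain ⟨a, apos, c, ac, c_lt⟩ :
      ∃ a : ℕ → NNReal, (∀ i : ℕ, 0 < a i) ∧ ∃ c : NNReal, HasSum a c ∧ c < 1 :=
    NNReal.exists_pos_sum_of_countable one_ne_zero ℕ
  have ac' : HasSum (fun n => (a n : ℝ)) c := NNReal.hasSum_coe.2 ac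
  have hm : ∀ n, ∃ m : ℝ, 0 < m ∧ m ≤ 1 ∧ ∀ x ∈ tsupport (g n), m ≤ δ x := by
    intro n
    rcases (tsupport (g n)).eq_empty_or_nonempty with h0 | h0
    · exact ⟨1, one_pos, le_rfl, by simp [h0]⟩
    · obtain ⟨y, hy, hmin⟩ := (g_comp_supp n).isCompact.exists_isMinOn h0 (hδ.mono (g_s n))
      exact ⟨min 1 (δ y), lt_min one_pos (hpos y (g_s n hy)), min_le_left _ _,
        fun x hx => (min_le_right _ _).trans (hmin hx)⟩
  choose m mpos m1 hm using hm
  have : ∀ n : ℕ, ∃ r : ℝ, 0 < r ∧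
      ∀ i ≤ n + 2, ∀ x, ‖iteratedFDeriv ℝ i (r • g n) x‖ ≤ a n * m n := by
    intro n
    have : ∀ i, ∃ R, ∀ x, ‖iteratedFDeriv ℝ i (fun x => g n x) x‖ ≤ R := by
      intro i
      have : BddAbove (range fun x => ‖iteratedFDeriv ℝ i (fun x : E => g n x) x‖) := by
        apply ((g_smooth n).continuous_iteratedFDeriv
          (mod_cast le_top)).norm.bddAbove_range_of_hasCompactSupport
        apply HasCompactSupport.comp_left _ norm_zero
        apply (g_comp_supp n).iteratedFDeriv
      rcases this with ⟨R, hR⟩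
      exact ⟨R, fun x => hR (mem_range_self _)⟩
    choose R hR using this
    let N := max (((Finset.range (n + 3)).image R).max' (by simp)) 1
    have IR : ∀ i ≤ n + 2, R i ≤ N := by
      intro i hi
      refine le_trans ?_ (le_max_left _ _)
      apply Finset.le_max'
      apply Finset.mem_image_of_mem
      simp only [Finset.mem_range]
      lia
    have Npos : 0 < N := one_pos.trans_le (le_max_right _ _)
    have anpos : (0 : ℝ) < a n * m n := mul_pos (apos n) (mpos n)
    refine ⟨N⁻¹ * (a n * m n), by positivity, fun i hi x => ?_⟩
    calc
      ‖iteratedFDeriv ℝ i ((N⁻¹ * (a n * m n)) • g n) x‖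
        = ‖(N⁻¹ * (a n * m n)) • iteratedFDeriv ℝ i (g n) x‖ := by
        rw [iteratedFDeriv_const_smul_apply]
        exact (g_smooth n).contDiffAt.of_le (mod_cast le_top)
      _ = N⁻¹ * (a n * m n) * ‖iteratedFDeriv ℝ i (g n) x‖ := by
        rw [norm_smul _ (iteratedFDeriv ℝ i (g n) x), Real.norm_of_nonneg]; positivity
      _ ≤ N⁻¹ * (a n * m n) * N := by gcongr; exact (hR i x).trans (IR i hi)
      _ = a n * m n := by field_simp
  choose r rpos hr using this
  have hr' : ∀ i n x, i ≤ n + 2 → ‖iteratedFDeriv ℝ i (r n • g n) x‖ ≤ a n :=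
    fun i n x hi => (hr n i hi x).trans (mul_le_of_le_one_right (a n).2 (m1 n))
  have S : ∀ x, Summable fun n => (r n • g n) x := fun x ↦ by
    refine .of_norm_bounded ac'.summable fun n => ?_
    simpa only [norm_iteratedFDeriv_zero] using! hr' 0 n x (Nat.zero_le _)
  have smooth : ∀ n, ContDiff ℝ ∞ (r n • g n) := fun n => (g_smooth n).const_smul (r n)
  have hsmooth : ContDiff ℝ ∞ fun x => ∑' n, (r n • g n) x := by
    refine contDiff_tsum_of_eventually smooth (fun k _ => ac'.summable) ?_
    intro i _
    simp only [Nat.cofinite_eq_atTop, Filter.eventually_atTop]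
    exact ⟨i, fun n hn x => hr' _ _ _ (by lia)⟩
  -- Only the indices with `x ∈ tsupport (g n)` contribute, and for these `m n ≤ δ x`.
  have hbound : ∀ i ≤ 2, ∀ x ∈ X, ‖iteratedFDeriv ℝ i (fun x => ∑' n, (r n • g n) x) x‖ ≤ δ x := by
    intro i hi x hx
    rw [iteratedFDeriv_tsum_apply (N := 2) (v := fun _ n => (a n : ℝ))
      (fun n => (smooth n).of_le (by exact_mod_cast le_top)) (fun k _ => ac'.summable)
      (fun k n x hk => hr' _ _ _ (by have : k ≤ 2 := by exact_mod_cast hk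
                                     lia)) (by exact_mod_cast hi)]
    have hle : ∀ n, ‖iteratedFDeriv ℝ i (r n • g n) x‖ ≤ a n * δ x := by
      intro n
      by_cases hxn : x ∈ tsupport (g n)
      · exact (hr n i (by lia) x).trans (mul_le_mul_of_nonneg_left (hm n x hxn) (a n).2)
      · have : iteratedFDeriv ℝ i (r n • g n) x = 0 := by
          rw [iteratedFDeriv_const_smul_apply ((g_smooth n).contDiffAt.of_le (mod_cast le_top))]
          have h2 : x ∉ support (iteratedFDeriv ℝ i (g n)) :=
            fun h => hxn (support_iteratedFDeriv_subset i h)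
          rw [notMem_support.1 h2, smul_zero]
        rw [this, norm_zero]
        exact mul_nonneg (a n).2 (hpos x hx).le
    have hs := ac'.mul_right (δ x)
    refine (tsum_of_norm_bounded hs hle).trans ?_
    exact mul_le_of_le_one_left (hpos x hx).le (by exact_mod_cast c_lt.le)
  refine ⟨fun x => ∑' n, (r n • g n) x, hsmooth, fun x hx => ?_, fun x hx => ⟨?_, ?_, ?_, ?_⟩⟩
  · have : ∀ n, g n x = 0 := fun n => by
      by_contra h
      exact hx (g_s n (subset_tsupport _ h))
    simp [this]
  · obtain ⟨n, hn⟩ := s_g x hx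
    have I : 0 < r n * g n x := mul_pos (rpos n) (lt_of_le_of_ne (g_nonneg n x) (Ne.symm hn))
    exact (S x).tsum_pos (fun i => mul_nonneg (rpos i).le (g_nonneg i x)) n I
  · have := hbound 0 (by norm_num) x hx
    rw [norm_iteratedFDeriv_zero] at this
    exact (le_abs_self _).trans this
  · have := hbound 1 (by norm_num) x hx
    rwa [← zero_add 1, ← norm_iteratedFDeriv_fderiv, norm_iteratedFDeriv_zero] at this
  · have := hbound 2 le_rfl x hx
    rwa [← one_add_one_eq_two, ← norm_iteratedFDeriv_fderiv, ← zero_add 1,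
      ← norm_iteratedFDeriv_fderiv, norm_iteratedFDeriv_zero] at this

/-- Every open set has a positive smooth function with compact sublevel sets. -/
theorem exists_smooth_exhaustion {X : Set E} (hX : IsOpen X) :
    ∃ h : E → ℝ, ContDiffOn ℝ ∞ h X ∧ (∀ x ∈ X, 0 < h x) ∧
      ∀ c : ℝ, IsCompact {x ∈ X | h x ≤ c} := by
  obtain ⟨η, hη, hη0, hηX⟩ := exists_contDiff_pos_le hX (δ := fun x => (1 + ‖x‖)⁻¹)
    (Continuous.continuousOn <| by
      refine Continuous.inv₀ (by fun_prop) fun x => by positivity) (fun x _ => by positivity)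
  refine ⟨fun x => (η x)⁻¹, hη.contDiffOn.inv fun x hx => (hηX x hx).1.ne',
    fun x hx => inv_pos.2 (hηX x hx).1, fun c => ?_⟩
  have hset : {x | x ∈ X ∧ (η x)⁻¹ ≤ c} = {x | 1 ≤ c * η x} := by
    ext x
    by_cases hx : x ∈ X
    · have := (hηX x hx).1
      simp only [mem_ofPred_eq, hx, true_and]
      rw [inv_le_iff_one_le_mul₀ this]
    · simp only [mem_ofPred_eq, hx, false_and, hη0 x hx, mul_zero, false_iff, not_le, zero_lt_one]
  rw [hset]
  refine Metric.isCompact_of_isClosed_isBounded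
    (isClosed_le continuous_const (continuous_const.mul hη.continuous)) ?_
  rw [isBounded_iff_forall_norm_le]
  refine ⟨c, fun x hx => ?_⟩
  have hx' : x ∈ {x | x ∈ X ∧ (η x)⁻¹ ≤ c} := hset ▸ hx
  have h1 := (hηX x hx'.1).2.1
  have h2 : 1 + ‖x‖ ≤ (η x)⁻¹ := by
    rw [le_inv_comm₀ (by positivity) (hηX x hx'.1).1]
    exact h1
  linarith [hx'.2]

end SmoothFunctions

/-! ### Nearest points of an embedded submanifold -/

section Submanifold

variable {n : ℕ}

local notation "𝔼" n:max => EuclideanSpace ℝ (Fin n)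

/-- A chart of the ambient space that carries `M` to the linear subspace `V`. -/
structure IsFlatteningChart (M : Set (𝔼 n)) (Φ : OpenPartialHomeomorph (𝔼 n) (𝔼 n))
    (V : Submodule ℝ (𝔼 n)) : Prop where
  contDiffOn : ContDiffOn ℝ ∞ Φ Φ.source
  contDiffOn_symm : ContDiffOn ℝ ∞ Φ.symm Φ.target
  mem_iff : ∀ y ∈ Φ.source, y ∈ M ↔ Φ y ∈ V

namespace IsFlatteningChart

variable {M : Set (𝔼 n)} {Φ : OpenPartialHomeomorph (𝔼 n) (𝔼 n)} {V : Submodule ℝ (𝔼 n)}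

theorem contDiffAt (h : IsFlatteningChart M Φ V) {p : 𝔼 n} (hp : p ∈ Φ.source) :
    ContDiffAt ℝ ∞ Φ p :=
  h.contDiffOn.contDiffAt (Φ.open_source.mem_nhds hp)

theorem contDiffAt_symm (h : IsFlatteningChart M Φ V) {z : 𝔼 n} (hz : z ∈ Φ.target) :
    ContDiffAt ℝ ∞ Φ.symm z :=
  h.contDiffOn_symm.contDiffAt (Φ.open_target.mem_nhds hz)

theorem symm_mem (h : IsFlatteningChart M Φ V) {z : 𝔼 n} (hz : z ∈ Φ.target) (hzV : z ∈ V) :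
    Φ.symm z ∈ M := by
  rw [h.mem_iff _ (Φ.map_target hz), Φ.right_inv hz]
  exact hzV

/-- In the chart, `M` contains the coordinate curve through `q` in the direction `u ∈ V`. -/
theorem exists_curve (h : IsFlatteningChart M Φ V) {q : 𝔼 n} (hq : q ∈ Φ.source) (hqM : q ∈ M)
    {u : 𝔼 n} (hu : u ∈ V) :
    ∃ γ : ℝ → 𝔼 n, ContDiffAt ℝ ∞ γ 0 ∧ γ 0 = q ∧ (∀ᶠ t in 𝓝 0, γ t ∈ M) ∧
      HasDerivAt γ (fderiv ℝ Φ.symm (Φ q) u) 0 := by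
  have hz : Φ q + (0 : ℝ) • u ∈ Φ.target := by simpa using Φ.map_source hq
  have hl : ContDiff ℝ ∞ fun t : ℝ => Φ q + t • u := by fun_prop
  refine ⟨fun t => Φ.symm (Φ q + t • u), ?_, by simp [hq], ?_, ?_⟩
  · exact ContDiffAt.comp (0 : ℝ) (h.contDiffAt_symm hz) hl.contDiffAt
  · have : ∀ᶠ t : ℝ in 𝓝 0, Φ q + t • u ∈ Φ.target :=
      hl.continuous.continuousAt.preimage_mem_nhds (Φ.open_target.mem_nhds hz)
    filter_upwards [this] with t ht
    exact h.symm_mem ht (V.add_mem ((h.mem_iff q hq).1 hqM) (V.smul_mem t hu))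
  · have h1 : HasDerivAt (fun t : ℝ => Φ q + t • u) u 0 := by
      simpa using ((hasDerivAt_id (0 : ℝ)).smul_const u).const_add (Φ q)
    have h2 : HasFDerivAt Φ.symm (fderiv ℝ Φ.symm (Φ q)) (Φ q + (0 : ℝ) • u) := by
      have := ((h.contDiffAt_symm hz).differentiableAt (by simp)).hasFDerivAt
      simpa using this
    exact h2.comp_hasDerivAt (0 : ℝ) h1

theorem fderiv_symm_mem_tangentSubspace (h : IsFlatteningChart M Φ V) {q : 𝔼 n}
    (hq : q ∈ Φ.source) (hqM : q ∈ M) {u : 𝔼 n} (hu : u ∈ V) :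
    fderiv ℝ Φ.symm (Φ q) u ∈ tangentSubspace M q := by
  obtain ⟨γ, h1, h2, h3, h4⟩ := h.exists_curve hq hqM hu
  exact Submodule.subset_span ⟨γ, h1, h2, h3, h4⟩

/-- The vector from a nearest point of `M` is normal to `M`. -/
theorem inner_fderiv_symm_eq_zero (h : IsFlatteningChart M Φ V) {q : 𝔼 n} (hq : q ∈ Φ.source)
    (hqM : q ∈ M) {x : 𝔼 n} (hx : ∀ᶠ q' in 𝓝 q, q' ∈ M → ‖x - q‖ ^ 2 ≤ ‖x - q'‖ ^ 2) {u : 𝔼 n}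
    (hu : u ∈ V) : inner ℝ (x - q) (fderiv ℝ Φ.symm (Φ q) u) = 0 := by
  obtain ⟨γ, h1, h2, h3, h4⟩ := h.exists_curve hq hqM hu
  have hmin : IsLocalMin (fun t => ‖x - γ t‖ ^ 2) 0 := by
    have hc : Tendsto γ (𝓝 0) (𝓝 q) := h2 ▸ h1.continuousAt
    filter_upwards [h3, hc.eventually hx] with t ht ht'
    simpa [h2] using ht' ht
  have hd := (h4.const_sub x).norm_sq
  have := hmin.hasDerivAt_eq_zero hd
  rw [h2, inner_neg_right] at this
  linarith

/-- A submanifold deviates from its tangent spaces by a quadratic error, uniformly near a point. -/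
theorem exists_norm_sub_sub_fderiv_le (h : IsFlatteningChart M Φ V) {p : 𝔼 n} (hp : p ∈ Φ.source) :
    ∃ C > 0, ∃ ρ > 0, ∀ q ∈ Metric.ball p ρ, ∀ q' ∈ Metric.ball p ρ,
      ‖q' - q - fderiv ℝ Φ.symm (Φ q) (Φ q' - Φ q)‖ ≤ C * ‖q' - q‖ ^ 2 := by
  have hz := Φ.map_source hp
  obtain ⟨K, t, ht, hK⟩ := ContDiffAt.exists_lipschitzOnWith
    (((h.contDiffAt_symm hz).of_le (ENat.LEInfty.out : (2 : ℕ∞ω) ≤ ∞)).fderiv_right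
      (m := 1) one_add_one_eq_two.le)
  obtain ⟨K', t', ht', hK'⟩ := ((h.contDiffAt hp).of_le
    (by exact_mod_cast le_top : (1 : ℕ∞ω) ≤ ∞)).exists_lipschitzOnWith
  obtain ⟨ε, hε, hball⟩ := Metric.mem_nhds_iff.1 (inter_mem ht (Φ.open_target.mem_nhds hz))
  have hnear : ∀ᶠ q in 𝓝 p, q ∈ Φ.source ∧ q ∈ t' ∧ Φ q ∈ Metric.ball (Φ p) ε :=
    Filter.Eventually.and (Φ.open_source.mem_nhds hp) (Filter.Eventually.and ht'
      ((Φ.continuousAt hp).preimage_mem_nhds (Metric.ball_mem_nhds _ hε)))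
  obtain ⟨ρ, hρ, hρball⟩ := Metric.eventually_nhds_iff_ball.1 hnear
  refine ⟨K * K' ^ 2 + 1, by positivity, ρ, hρ, fun q hq q' hq' => ?_⟩
  obtain ⟨hqs, hqt, hqε⟩ := hρball q hq
  obtain ⟨hqs', hqt', hqε'⟩ := hρball q' hq'
  have hmv := Convex.norm_image_sub_le_of_norm_fderiv_le' (𝕜 := ℝ) (f := Φ.symm)
    (φ := fderiv ℝ Φ.symm (Φ q)) (C := K * ‖Φ q' - Φ q‖) (x := Φ q) (y := Φ q')
    (s := Metric.ball (Φ p) ε ∩ Metric.closedBall (Φ q) ‖Φ q' - Φ q‖)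
    (fun z hz => (h.contDiffAt_symm (hball hz.1).2).differentiableAt (by simp))
    (fun z hz => by
      refine (hK.norm_sub_le (hball hz.1).1 (hball hqε).1).trans ?_
      exact mul_le_mul_of_nonneg_left (mem_closedBall_iff_norm.1 hz.2) K.2)
    ((convex_ball _ _).inter (convex_closedBall _ _))
    ⟨hqε, Metric.mem_closedBall_self (norm_nonneg _)⟩ ⟨hqε', mem_closedBall_iff_norm.2 le_rfl⟩
  rw [Φ.left_inv hqs, Φ.left_inv hqs'] at hmv
  have hL : ‖Φ q' - Φ q‖ ≤ K' * ‖q' - q‖ := hK'.norm_sub_le hqt' hqt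
  calc _ ≤ K * ‖Φ q' - Φ q‖ * ‖Φ q' - Φ q‖ := hmv
    _ ≤ K * (K' * ‖q' - q‖) * (K' * ‖q' - q‖) := by gcongr
    _ ≤ (K * K' ^ 2 + 1) * ‖q' - q‖ ^ 2 := by nlinarith [sq_nonneg ‖q' - q‖]

/-- Near a point of `M` the distance to `M` is controlled by the distance to `V` in the chart. -/
theorem exists_infDist_le (h : IsFlatteningChart M Φ V) {p : 𝔼 n} (hp : p ∈ Φ.source)
    (hpM : p ∈ M) :
    ∃ L : ℝ, 0 ≤ L ∧ ∀ᶠ x in 𝓝 p, Metric.infDist x M ≤ L * ‖Φ x - V.starProjection (Φ x)‖ := by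
  have hz := Φ.map_source hp
  have hzV : V.starProjection (Φ p) = Φ p :=
    Submodule.starProjection_eq_self_iff.2 ((h.mem_iff p hp).1 hpM)
  obtain ⟨K, t, ht, hK⟩ := ((h.contDiffAt_symm hz).of_le
    (by exact_mod_cast le_top : (1 : ℕ∞ω) ≤ ∞)).exists_lipschitzOnWith
  have hc := Φ.continuousAt hp
  have hc' : ContinuousAt (fun x => V.starProjection (Φ x)) p :=
    V.starProjection.continuous.continuousAt.comp hc
  refine ⟨K, K.2, ?_⟩
  filter_upwards [Φ.open_source.mem_nhds hp, hc.preimage_mem_nhds ht,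
    hc'.preimage_mem_nhds (hzV.symm ▸ ht),
    hc'.preimage_mem_nhds (hzV.symm ▸ Φ.open_target.mem_nhds hz)] with x hx h1 h2 h3
  have hmem : Φ.symm (V.starProjection (Φ x)) ∈ M :=
    h.symm_mem h3 (Submodule.starProjection_apply_mem _ _)
  refine (Metric.infDist_le_dist_of_mem hmem).trans ?_
  have := hK.norm_sub_le h1 h2
  rwa [Φ.left_inv hx, ← dist_eq_norm] at this

end IsFlatteningChart

variable {X M : Set (𝔼 n)}

theorem IsClosedSubmanifold.exists_chart (hM : IsClosedSubmanifold X M) {p : 𝔼 n} (hp : p ∈ M) :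
    ∃ Φ V, p ∈ Φ.source ∧ IsFlatteningChart M Φ V := by
  obtain ⟨Φ, V, h1, h2, h3, h4⟩ := hM.embedded p hp
  exact ⟨Φ, V, h1, h2, h3, h4⟩

theorem IsClosedSubmanifold.infDist_pos (hM : IsClosedSubmanifold X M) (hne : M.Nonempty) {x : 𝔼 n}
    (hx : x ∈ X) (hxM : x ∉ M) : 0 < Metric.infDist x M :=
  (Metric.infDist_pos_iff_notMem_closure hne).1 fun h => hxM (hM.closed ⟨h, hx⟩)

/-- `q ∈ M` is a nearest point to `x` in a quantitative sense, which makes it unique. -/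
def IsStrongNearestPoint (M : Set (𝔼 n)) (x q : 𝔼 n) : Prop :=
  q ∈ M ∧ ∀ q' ∈ M, ‖x - q‖ ^ 2 + ‖q - q'‖ ^ 2 / 2 ≤ ‖x - q'‖ ^ 2

theorem IsStrongNearestPoint.norm_sub_le {x q q' : 𝔼 n} (h : IsStrongNearestPoint M x q)
    (hq' : q' ∈ M) : ‖x - q‖ ≤ ‖x - q'‖ := by
  refine le_of_sq_le_sq ?_ (norm_nonneg _)
  linarith [h.2 q' hq', sq_nonneg ‖q - q'‖]

theorem IsStrongNearestPoint.norm_sub_le_infDist {x q : 𝔼 n} (h : IsStrongNearestPoint M x q) :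
    ‖x - q‖ ≤ Metric.infDist x M := by
  rw [Metric.le_infDist ⟨q, h.1⟩]
  intro q' hq'
  rw [dist_eq_norm]
  exact h.norm_sub_le hq'

theorem IsStrongNearestPoint.eq_of_mem {x q : 𝔼 n} (h : IsStrongNearestPoint M x q) (hx : x ∈ M) :
    q = x := by
  have := h.norm_sub_le hx
  rw [sub_self, norm_zero, norm_le_zero_iff, sub_eq_zero] at this
  exact this.symm

theorem continuousOn_of_isStrongNearestPoint {S : Set (𝔼 n)} {r : 𝔼 n → 𝔼 n}
    (h : ∀ x ∈ S, IsStrongNearestPoint M x (r x)) : ContinuousOn r S := by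
  intro x hx
  rw [ContinuousWithinAt, tendsto_iff_norm_sub_tendsto_zero]
  have hb : ∀ y ∈ S, ‖r y - r x‖ ^ 2 ≤ 2 * ((2 * ‖x - y‖ + ‖x - r x‖) ^ 2 - ‖x - r x‖ ^ 2) := by
    intro y hy
    have h1 := (h x hx).2 (r y) (h y hy).1
    have h2 := (h y hy).norm_sub_le (h x hx).1
    have h3 : ‖x - r y‖ ≤ 2 * ‖x - y‖ + ‖x - r x‖ := by
      have e1 : ‖x - r y‖ ≤ ‖x - y‖ + ‖y - r y‖ := by
        simpa using norm_add_le (x - y) (y - r y)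
      have e2 : ‖y - r x‖ ≤ ‖x - y‖ + ‖x - r x‖ := by
        have := norm_add_le (y - x) (x - r x)
        rw [norm_sub_rev y x] at this
        simpa using this
      linarith
    have h4 : ‖x - r y‖ ^ 2 ≤ (2 * ‖x - y‖ + ‖x - r x‖) ^ 2 :=
      pow_le_pow_left₀ (norm_nonneg _) h3 2
    rw [norm_sub_rev (r y)]
    linarith
  have hlim : Tendsto (fun y => ‖r y - r x‖ ^ 2) (𝓝[S] x) (𝓝 0) := by
    refine squeeze_zero' (.of_forall fun y => by positivity)
      (eventually_nhdsWithin_of_forall hb) ?_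
    have hc : Continuous fun y => 2 * ((2 * ‖x - y‖ + ‖x - r x‖) ^ 2 - ‖x - r x‖ ^ 2) := by
      fun_prop
    have := hc.tendsto x
    simp only [sub_self, norm_zero, mul_zero, zero_add] at this
    exact this.mono_left nhdsWithin_le_nhds
  have := hlim.sqrt
  simpa [Real.sqrt_sq (norm_nonneg _)] using this

/-- Every point near `M` has a strong nearest point in `M`. For competitors near the nearest point
this follows from the quadratic estimate, since `x - q` is normal to `M`; distant competitors lose
by the triangle inequality. -/
theorem IsClosedSubmanifold.eventually_exists_isStrongNearestPoint (hX : IsOpen X)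
    (hM : IsClosedSubmanifold X M) {p : 𝔼 n} (hp : p ∈ M) :
    ∀ᶠ x in 𝓝 p, ∃ q, IsStrongNearestPoint M x q := by
  obtain ⟨Φ, V, hpΦ, hΦ⟩ := hM.exists_chart hp
  obtain ⟨C, hC, ρ₀, hρ₀, hquad⟩ := hΦ.exists_norm_sub_sub_fderiv_le hpΦ
  obtain ⟨ρ, hρ, hρball⟩ := Metric.nhds_basis_closedBall.mem_iff.1
    (inter_mem (inter_mem (Φ.open_source.mem_nhds hpΦ) (hX.mem_nhds (hM.subset hp)))
      (Metric.ball_mem_nhds p hρ₀))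
  have hcomp : IsCompact (M ∩ Metric.closedBall p ρ) := by
    have : M ∩ Metric.closedBall p ρ = closure M ∩ Metric.closedBall p ρ := by
      refine subset_antisymm (inter_subset_inter_left _ subset_closure) fun x hx => ?_
      exact ⟨hM.closed ⟨hx.1, (hρball hx.2).1.2⟩, hx.2⟩
    rw [this]
    exact (isCompact_closedBall p ρ).inter_left isClosed_closure
  obtain ⟨s, hs, hs1, hs2⟩ : ∃ s > 0, s * 9 ≤ ρ ∧ s * C ≤ 1 / 4 := by
    refine ⟨min (ρ / 9) (1 / (4 * C)), by positivity, ?_, ?_⟩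
    · have := min_le_left (ρ / 9) (1 / (4 * C))
      linarith
    · have := mul_le_mul_of_nonneg_right (min_le_right (ρ / 9) (1 / (4 * C))) hC.le
      refine this.trans (le_of_eq ?_)
      field_simp
  filter_upwards [Metric.ball_mem_nhds p hs] with x hx
  rw [mem_ball_iff_norm] at hx
  have hpK : p ∈ M ∩ Metric.closedBall p ρ := ⟨hp, Metric.mem_closedBall_self hρ.le⟩
  obtain ⟨q, ⟨hqM, hqρ⟩, hmin⟩ := hcomp.exists_isMinOn ⟨p, hpK⟩
    (f := fun q => ‖x - q‖ ^ 2) (by fun_prop)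
  have hmin' : ∀ q' ∈ M, q' ∈ Metric.closedBall p ρ → ‖x - q‖ ^ 2 ≤ ‖x - q'‖ ^ 2 :=
    fun q' h1 h2 => hmin ⟨h1, h2⟩
  have hxq : ‖x - q‖ < s := by
    have := le_of_sq_le_sq (hmin' p hp hpK.2) (norm_nonneg _)
    linarith
  have hqp : ‖q - p‖ < 2 * s := by
    have := norm_sub_le (x - p) (x - q)
    rw [sub_sub_sub_cancel_left] at this
    linarith
  have hortho : ∀ u ∈ V, inner ℝ (x - q) (fderiv ℝ Φ.symm (Φ q) u) = 0 := by
    intro u hu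
    refine hΦ.inner_fderiv_symm_eq_zero (hρball hqρ).1.1 hqM ?_ hu
    have : Metric.ball p ρ ∈ 𝓝 q := by
      refine Metric.isOpen_ball.mem_nhds ?_
      rw [mem_ball_iff_norm]
      linarith
    filter_upwards [this] with q' hq' hq'M
    exact hmin' q' hq'M (Metric.ball_subset_closedBall hq')
  refine ⟨q, hqM, fun q' hq' => ?_⟩
  by_cases hfar : q' ∈ Metric.closedBall p ρ
  · have hV : Φ q' - Φ q ∈ V := V.sub_mem ((hΦ.mem_iff q' (hρball hfar).1.1).1 hq')
      ((hΦ.mem_iff q (hρball hqρ).1.1).1 hqM)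
    have h1 := hquad q (hρball hqρ).2 q' (hρball hfar).2
    have h2 : inner ℝ (x - q) (q' - q) =
        inner ℝ (x - q) (q' - q - fderiv ℝ Φ.symm (Φ q) (Φ q' - Φ q)) := by
      rw [inner_sub_right _ (q' - q), hortho _ hV, sub_zero]
    have h3 : inner ℝ (x - q) (q' - q) ≤ ‖q' - q‖ ^ 2 / 4 := by
      rw [h2]
      calc _ ≤ ‖x - q‖ * ‖q' - q - fderiv ℝ Φ.symm (Φ q) (Φ q' - Φ q)‖ :=
            real_inner_le_norm _ _
        _ ≤ s * (C * ‖q' - q‖ ^ 2) := by gcongr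
        _ = s * C * ‖q' - q‖ ^ 2 := by ring
        _ ≤ 1 / 4 * ‖q' - q‖ ^ 2 := by gcongr
        _ = _ := by ring
    have h4 := norm_sub_sq_real (x - q) (q' - q)
    rw [sub_sub_sub_cancel_right] at h4
    rw [norm_sub_rev q q', h4]
    linarith
  · rw [Metric.mem_closedBall, not_le, dist_eq_norm] at hfar
    have h1 : ‖q - q'‖ ≤ ‖q' - p‖ + 2 * s := by
      have := norm_sub_le (q - p) (q' - p)
      rw [sub_sub_sub_cancel_right] at this
      linarith
    have h2 : ‖q' - p‖ - s ≤ ‖x - q'‖ := by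
      have := norm_sub_le (x - p) (x - q')
      rw [sub_sub_sub_cancel_left] at this
      linarith
    have h3 : (‖q' - p‖ - s) ^ 2 ≤ ‖x - q'‖ ^ 2 := pow_le_pow_left₀ (by linarith) h2 2
    have h4 : ‖q - q'‖ ^ 2 ≤ (‖q' - p‖ + 2 * s) ^ 2 := pow_le_pow_left₀ (norm_nonneg _) h1 2
    have h5 : ‖x - q‖ ^ 2 ≤ s ^ 2 := pow_le_pow_left₀ (norm_nonneg _) hxq.le 2
    nlinarith

/-- There is a smooth function on `X` that vanishes on `M` and dominates the squared distance
to `M`. -/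
theorem IsClosedSubmanifold.exists_sq_infDist_le (hX : IsOpen X) (hM : IsClosedSubmanifold X M) :
    ∃ f : 𝔼 n → ℝ, ContDiffOn ℝ ∞ f X ∧ (∀ x ∈ X, Metric.infDist x M ^ 2 ≤ f x) ∧
      ∀ x ∈ M, f x = 0 := by
  have hconv : ∀ x ∈ X, Convex ℝ {y : ℝ | Metric.infDist x M ^ 2 ≤ y ∧ (x ∈ M → y = 0)} := by
    intro x _
    refine OrdConnected.convex ⟨fun a ha b hb c hc => ⟨ha.1.trans hc.1, fun hx => ?_⟩⟩
    exact le_antisymm (hc.2.trans_eq (hb.2 hx)) ((ha.2 hx).symm.trans_le hc.1)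
  obtain ⟨f, hf, hfX⟩ := exists_contDiffOn_forall_mem_convex hX hconv fun p hp => by
    by_cases hpM : p ∈ M
    · obtain ⟨Φ, V, hpΦ, hΦ⟩ := hM.exists_chart hpM
      obtain ⟨L, hL, hev⟩ := hΦ.exists_infDist_le hpΦ hpM
      refine ⟨fun x => L ^ 2 * ‖Φ x - V.starProjection (Φ x)‖ ^ 2, _,
        inter_mem hev (Φ.open_source.mem_nhds hpΦ), ?_, ?_⟩
      · have h1 : ContDiffOn ℝ ∞ Φ ({x | Metric.infDist x M ≤
            L * ‖Φ x - V.starProjection (Φ x)‖} ∩ Φ.source) :=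
          hΦ.contDiffOn.mono inter_subset_right
        exact contDiffOn_const.mul
          ((h1.sub (V.starProjection.contDiff.comp_contDiffOn h1)).norm_sq ℝ)
      · rintro x ⟨h1, h2⟩ -
        refine ⟨?_, fun hx => ?_⟩ <;> beta_reduce
        · rw [← mul_pow]
          exact pow_le_pow_left₀ Metric.infDist_nonneg h1 2
        · rw [Submodule.starProjection_eq_self_iff.2 ((hΦ.mem_iff x h2).1 hx)]
          simp
    · have hnhds : (closure M)ᶜ ∈ 𝓝 p :=
        isClosed_closure.isOpen_compl.mem_nhds fun h => hpM (hM.closed ⟨h, hp⟩)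
      have hcont : Continuous fun x => Metric.infDist x M ^ 2 :=
        (Metric.continuous_infDist_pt M).pow 2
      refine ⟨fun _ => Metric.infDist p M ^ 2 + 1, _, inter_mem hnhds
        ((hcont.tendsto p).eventually (gt_mem_nhds (lt_add_one _))), contDiffOn_const, ?_⟩
      rintro x ⟨h1, h2⟩ -
      exact ⟨le_of_lt h2, fun hx => absurd (subset_closure hx) h1⟩
  exact ⟨f, hf, fun x hx => (hfX x hx).1, fun x hx => (hfX x (hM.subset hx)).2 hx⟩

end Submanifold

/-! ### Second derivatives of sums, products and inverses -/

section SecondDerivative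

variable {E : Type*} [NormedAddCommGroup E] [NormedSpace ℝ E] {u v : E → ℝ} {p : E}

theorem ContDiffAt.differentiableAt_fderiv (hu : ContDiffAt ℝ 2 u p) :
    DifferentiableAt ℝ (fderiv ℝ u) p :=
  (hu.fderiv_right (m := 1) one_add_one_eq_two.le).differentiableAt one_ne_zero

theorem ContDiffAt.eventually_differentiableAt (hu : ContDiffAt ℝ 2 u p) :
    ∀ᶠ y in 𝓝 p, DifferentiableAt ℝ u y := by
  filter_upwards [hu.eventually (by simp)] with y hy
  exact hy.differentiableAt two_ne_zero

theorem ContDiffAt.continuousAt_fderiv_fderiv (hu : ContDiffAt ℝ 2 u p) :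
    ContinuousAt (fderiv ℝ (fderiv ℝ u)) p :=
  ((hu.fderiv_right (m := 1) one_add_one_eq_two.le).fderiv_right (m := 0)
    (zero_add 1).le).continuousAt

theorem fderiv_fderiv_add (hu : ContDiffAt ℝ 2 u p) (hv : ContDiffAt ℝ 2 v p) :
    fderiv ℝ (fderiv ℝ fun x => u x + v x) p =
      fderiv ℝ (fderiv ℝ u) p + fderiv ℝ (fderiv ℝ v) p := by
  have h : fderiv ℝ (fun x => u x + v x) =ᶠ[𝓝 p] fun y => fderiv ℝ u y + fderiv ℝ v y := by
    filter_upwards [hu.eventually_differentiableAt, hv.eventually_differentiableAt] with y h1 h2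
    exact fderiv_fun_add h1 h2
  rw [h.fderiv_eq, fderiv_fun_add hu.differentiableAt_fderiv hv.differentiableAt_fderiv]

theorem fderiv_fderiv_sub (hu : ContDiffAt ℝ 2 u p) (hv : ContDiffAt ℝ 2 v p) :
    fderiv ℝ (fderiv ℝ fun x => u x - v x) p =
      fderiv ℝ (fderiv ℝ u) p - fderiv ℝ (fderiv ℝ v) p := by
  have h : fderiv ℝ (fun x => u x - v x) =ᶠ[𝓝 p] fun y => fderiv ℝ u y - fderiv ℝ v y := by
    filter_upwards [hu.eventually_differentiableAt, hv.eventually_differentiableAt] with y h1 h2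
    exact fderiv_fun_sub h1 h2
  rw [h.fderiv_eq, fderiv_fun_sub hu.differentiableAt_fderiv hv.differentiableAt_fderiv]

theorem fderiv_fderiv_const_mul (hu : ContDiffAt ℝ 2 u p) (c : ℝ) :
    fderiv ℝ (fderiv ℝ fun x => c * u x) p = c • fderiv ℝ (fderiv ℝ u) p := by
  have h : fderiv ℝ (fun x => c * u x) =ᶠ[𝓝 p] fun y => c • fderiv ℝ u y := by
    filter_upwards [hu.eventually_differentiableAt] with y h1
    exact fderiv_const_mul h1 c
  rw [h.fderiv_eq, fderiv_fun_const_smul hu.differentiableAt_fderiv]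

theorem fderiv_fderiv_mul (hu : ContDiffAt ℝ 2 u p) (hv : ContDiffAt ℝ 2 v p) :
    fderiv ℝ (fderiv ℝ fun x => u x * v x) p =
      (u p • fderiv ℝ (fderiv ℝ v) p + (fderiv ℝ u p).smulRight (fderiv ℝ v p)) +
      (v p • fderiv ℝ (fderiv ℝ u) p + (fderiv ℝ v p).smulRight (fderiv ℝ u p)) := by
  have h : fderiv ℝ (fun x => u x * v x) =ᶠ[𝓝 p]
      fun y => u y • fderiv ℝ v y + v y • fderiv ℝ u y := by
    filter_upwards [hu.eventually_differentiableAt, hv.eventually_differentiableAt] with y h1 h2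
    exact fderiv_fun_mul h1 h2
  have hu' := (hu.differentiableAt two_ne_zero).hasFDerivAt
  have hv' := (hv.differentiableAt two_ne_zero).hasFDerivAt
  rw [h.fderiv_eq]
  exact ((hu'.fun_smul hv.differentiableAt_fderiv.hasFDerivAt).fun_add
    (hv'.fun_smul hu.differentiableAt_fderiv.hasFDerivAt)).fderiv

theorem norm_neg_fderiv_fderiv_mul_self_le (hu : ContDiffAt ℝ 2 u p) {s : ℝ} (h0 : ‖u p‖ ≤ s)
    (h1 : ‖fderiv ℝ u p‖ ≤ s) (h2 : ‖fderiv ℝ (fderiv ℝ u) p‖ ≤ s) :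
    ‖-fderiv ℝ (fderiv ℝ fun x => u x * u x) p‖ ≤ 4 * s ^ 2 := by
  have hs : 0 ≤ s := (norm_nonneg _).trans h0
  rw [ContinuousLinearMap.opNorm_neg, fderiv_fderiv_mul hu hu]
  have e1 : ‖u p • fderiv ℝ (fderiv ℝ u) p‖ ≤ s * s :=
    (ContinuousLinearMap.opNorm_smul_le _ _).trans (by gcongr)
  have e2 : ‖(fderiv ℝ u p).smulRight (fderiv ℝ u p)‖ ≤ s * s := by
    rw [ContinuousLinearMap.norm_smulRight_apply]
    gcongr
  refine (norm_add_le_of_le (norm_add_le_of_le e1 e2) (norm_add_le_of_le e1 e2)).trans ?_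
  linarith

theorem fderiv_fderiv_inv (hu : ContDiffAt ℝ 2 u p) (h0 : u p ≠ 0) :
    fderiv ℝ (fderiv ℝ fun x => (u x)⁻¹) p =
      (u p ^ 2)⁻¹ • -fderiv ℝ (fderiv ℝ u) p +
        (2 * (u p ^ 3)⁻¹) • (fderiv ℝ u p).smulRight (fderiv ℝ u p) := by
  have h : fderiv ℝ (fun x => (u x)⁻¹) =ᶠ[𝓝 p] fun y => (-(u y ^ 2)⁻¹) • fderiv ℝ u y := by
    filter_upwards [hu.eventually_differentiableAt, hu.continuousAt.eventually_ne h0] with y h1 h2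
    exact ((hasDerivAt_inv h2).comp_hasFDerivAt y h1.hasFDerivAt).fderiv
  have hu' := (hu.differentiableAt two_ne_zero).hasFDerivAt
  have h1 : HasFDerivAt (fun y => -(u y ^ 2)⁻¹) ((2 * (u p ^ 3)⁻¹) • fderiv ℝ u p) p := by
    have h2 : HasDerivAt (fun s : ℝ => -(s ^ 2)⁻¹) (2 * (u p ^ 3)⁻¹) (u p) := by
      refine ((hasDerivAt_pow 2 (u p)).fun_inv (pow_ne_zero 2 h0)).fun_neg.congr_deriv ?_
      field_simp
      norm_num
      ring
    exact h2.comp_hasFDerivAt p hu'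
  rw [h.fderiv_eq, (h1.fun_smul hu.differentiableAt_fderiv.hasFDerivAt).fderiv]
  ext w w'
  simp
  ring

/-- The second-order Taylor expansion along a line at a critical point with critical value zero. -/
theorem eventually_abs_sub_le_of_fderiv_eq_zero (hu : ContDiffAt ℝ 2 u p) (h0 : u p = 0)
    (h1 : fderiv ℝ u p = 0) (w : E) {ε : ℝ} (hε : 0 < ε) :
    ∀ᶠ t : ℝ in 𝓝 0, |u (p + t • w) - t ^ 2 / 2 * fderiv ℝ (fderiv ℝ u) p w w| ≤ ε * t ^ 2 := by
  set a := fderiv ℝ (fderiv ℝ u) p w w with ha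
  have hl : ∀ t : ℝ, HasDerivAt (fun t : ℝ => p + t • w) w t := fun t => by
    simpa using ((hasDerivAt_id t).smul_const w).const_add p
  have hl0 : Tendsto (fun t : ℝ => p + t • w) (𝓝 0) (𝓝 p) := by
    simpa using (hl 0).continuousAt.tendsto
  -- The derivative `s ↦ Du (p + s w) w` is `s a + o(s)`; the estimate follows by integration.
  have hd : HasDerivAt (fun s : ℝ => fderiv ℝ u (p + s • w) w) a 0 := by
    have h2 : HasFDerivAt (fderiv ℝ u) (fderiv ℝ (fderiv ℝ u) p) (p + (0 : ℝ) • w) := by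
      simpa using hu.differentiableAt_fderiv.hasFDerivAt
    have h3 := h2.comp_hasDerivAt (0 : ℝ) (hl 0)
    simpa using! h3.clm_apply (hasDerivAt_const (0 : ℝ) w)
  have hlo : ∀ᶠ s : ℝ in 𝓝 0, |fderiv ℝ u (p + s • w) w - s * a| ≤ ε * |s| := by
    have := hd.isLittleO.def hε
    filter_upwards [this] with s hs
    simpa [h1] using hs
  obtain ⟨ρ, hρ, hball⟩ := Metric.eventually_nhds_iff_ball.1
    (hlo.and (hl0.eventually hu.eventually_differentiableAt))
  filter_upwards [Metric.ball_mem_nhds (0 : ℝ) hρ] with t ht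
  have hmem : ∀ s ∈ Metric.closedBall (0 : ℝ) |t|, s ∈ Metric.ball (0 : ℝ) ρ := fun s hs => by
    rw [mem_closedBall_zero_iff, Real.norm_eq_abs] at hs
    rw [mem_ball_zero_iff, Real.norm_eq_abs] at ht ⊢
    exact hs.trans_lt ht
  have hmv := (convex_closedBall (0 : ℝ) |t|).norm_image_sub_le_of_norm_hasDerivWithin_le
    (f := fun s => u (p + s • w) - s ^ 2 / 2 * a) (f' := fun s => fderiv ℝ u (p + s • w) w - s * a)
    (C := ε * |t|) (x := 0) (y := t) (fun s hs => by
      have e1 := ((hball s (hmem s hs)).2.hasFDerivAt).comp_hasDerivAt s (hl s)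
      have e2 : HasDerivAt (fun s : ℝ => s ^ 2 / 2 * a) (s * a) s := by
        have := (((hasDerivAt_id s).pow 2).div_const 2).mul_const a
        refine this.congr_deriv ?_
        simp
      exact (e1.sub e2).hasDerivWithinAt)
    (fun s hs => by
      refine ((hball s (hmem s hs)).1).trans ?_
      rw [mem_closedBall_zero_iff, Real.norm_eq_abs] at hs
      gcongr)
    (by simp) (by simp)
  simp only [Real.norm_eq_abs, zero_smul, add_zero, h0, sub_zero] at hmv
  refine (le_of_eq ?_).trans (hmv.trans (le_of_eq ?_))
  · simp
  · rw [mul_assoc, abs_mul_abs_self, sq]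

end SecondDerivative

/-- A property that holds near `(p, 0)` holds uniformly for small second components. -/
theorem exists_eventually_forall_norm_le {E F : Type*} [SeminormedAddCommGroup E]
    [SeminormedAddCommGroup F] {p : E} {R : E × F → Prop} (h : ∀ᶠ z in 𝓝 (p, 0), R z) :
    ∃ ε > 0, ∀ᶠ x in 𝓝 p, ∀ C : F, ‖C‖ ≤ ε → R (x, C) := by
  obtain ⟨ε, hε, hball⟩ := Metric.eventually_nhds_iff_ball.1 h
  refine ⟨ε / 2, half_pos hε, ?_⟩
  filter_upwards [Metric.ball_mem_nhds p hε] with x hx C hC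
  refine hball (x, C) ?_
  rw [Metric.mem_ball, Prod.dist_eq, max_lt_iff, dist_zero_right]
  exact ⟨hx, hC.trans_lt (half_lt_self hε)⟩

/-! ### Functions vanishing to second order exactly on a free submanifold -/

section DefiningFunction

variable {n : ℕ}

local notation "𝔼" n:max => EuclideanSpace ℝ (Fin n)

variable {X M : Set (𝔼 n)} {f : 𝔼 n → ℝ} {p : 𝔼 n}

theorem fderiv_eq_zero_of_infDist_sq_le (h : ∀ᶠ x in 𝓝 p, Metric.infDist x M ^ 2 ≤ f x)
    (h0 : f p = 0) : fderiv ℝ f p = 0 := by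
  refine IsLocalMin.fderiv_eq_zero ?_
  filter_upwards [h] with x hx
  rw [h0]
  exact (sq_nonneg _).trans hx

theorem fderiv_fderiv_nonneg_of_infDist_sq_le (hf : ContDiffAt ℝ 2 f p)
    (h : ∀ᶠ x in 𝓝 p, Metric.infDist x M ^ 2 ≤ f x) (h0 : f p = 0) (w : 𝔼 n) :
    0 ≤ fderiv ℝ (fderiv ℝ f) p w w := by
  by_contra! hneg
  have hl0 : Tendsto (fun t : ℝ => p + t • w) (𝓝 0) (𝓝 p) := by
    have : Continuous fun t : ℝ => p + t • w := by fun_prop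
    simpa using this.tendsto 0
  have h1 := eventually_abs_sub_le_of_fderiv_eq_zero hf h0 (fderiv_eq_zero_of_infDist_sq_le h h0) w
    (ε := -fderiv ℝ (fderiv ℝ f) p w w / 4) (by linarith)
  obtain ⟨t, ⟨ht1, ht2⟩, ht0⟩ := (((h1.and (hl0.eventually h)).filter_mono
    nhdsWithin_le_nhds).and (self_mem_nhdsWithin (s := {0}ᶜ))).exists
  have ht0' : 0 < t ^ 2 := by
    have : t ≠ 0 := ht0
    positivity
  have h2 := (abs_le.1 ht1).2
  have h3 := (sq_nonneg _).trans ht2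
  nlinarith

/-- Null vectors of the Hessian are tangent to `M`: along such a direction the distance to `M` is
`o(t)`. -/
theorem IsFlatteningChart.exists_eq_fderiv_symm_of_fderiv_fderiv_le
    {Φ : OpenPartialHomeomorph (𝔼 n) (𝔼 n)} {V : Submodule ℝ (𝔼 n)}
    (hΦ : IsFlatteningChart M Φ V) (hpΦ : p ∈ Φ.source) (hpM : p ∈ M)
    (hf : ContDiffAt ℝ 2 f p)
    (h : ∀ᶠ x in 𝓝 p, Metric.infDist x M ^ 2 ≤ f x) (h0 : f p = 0) {w : 𝔼 n}
    (hw : fderiv ℝ (fderiv ℝ f) p w w ≤ 0) :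
    ∃ u ∈ V, fderiv ℝ Φ.symm (Φ p) u = w := by
  have hl : HasDerivAt (fun t : ℝ => p + t • w) w 0 := by
    simpa using ((hasDerivAt_id (0 : ℝ)).smul_const w).const_add p
  have hl0 : Tendsto (fun t : ℝ => p + t • w) (𝓝 0) (𝓝 p) := by
    simpa using hl.continuousAt.tendsto
  have hΦd : HasFDerivAt Φ (fderiv ℝ Φ p) p :=
    ((hΦ.contDiffAt hpΦ).differentiableAt (by simp)).hasFDerivAt
  have hΨd : HasFDerivAt Φ.symm (fderiv ℝ Φ.symm (Φ p)) (Φ p) :=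
    ((hΦ.contDiffAt_symm (Φ.map_source hpΦ)).differentiableAt (by simp)).hasFDerivAt
  refine ⟨fderiv ℝ Φ p w, ?_, ?_⟩
  · -- `G` measures the distance to `V` in the chart; its derivative along `w` is shown to vanish.
    let G : 𝔼 n → 𝔼 n := fun x => Φ x - V.starProjection (Φ x)
    have hGd : HasFDerivAt G (fderiv ℝ Φ p - V.starProjection ∘L fderiv ℝ Φ p) p :=
      hΦd.sub (V.starProjection.hasFDerivAt.comp p hΦd)
    have hG0 : ∀ q ∈ Φ.source, q ∈ M → G q = 0 := fun q hq hqM => by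
      simp only [G]
      rw [Submodule.starProjection_eq_self_iff.2 ((hΦ.mem_iff q hq).1 hqM), sub_self]
    have hGc : ContDiffAt ℝ 1 G p := by
      have h1 : ContDiffAt ℝ 1 Φ p := (hΦ.contDiffAt hpΦ).of_le ENat.LEInfty.out
      exact h1.sub (V.starProjection.contDiff.contDiffAt.comp p h1)
    obtain ⟨K, t, ht, hK⟩ := hGc.exists_lipschitzOnWith
    have hGl : HasDerivAt (fun t : ℝ => G (p + t • w))
        (fderiv ℝ Φ p w - V.starProjection (fderiv ℝ Φ p w)) 0 := by
      have : HasFDerivAt G (fderiv ℝ Φ p - V.starProjection ∘L fderiv ℝ Φ p)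
        (p + (0 : ℝ) • w) := by simpa using hGd
      exact this.comp_hasDerivAt (0 : ℝ) hl
    have hbound : ∀ ε > 0, ‖fderiv ℝ Φ p w - V.starProjection (fderiv ℝ Φ p w)‖ ≤ K * ε := by
      intro ε hε
      refine hGl.le_of_lip' (mul_nonneg K.2 hε.le) ?_
      have hT := eventually_abs_sub_le_of_fderiv_eq_zero hf h0
        (fderiv_eq_zero_of_infDist_sq_le h h0) w (ε := (ε / 2) ^ 2) (by positivity)
      obtain ⟨ρ, hρ, hball⟩ := Metric.mem_nhds_iff.1
        (inter_mem ht (Φ.open_source.mem_nhds hpΦ))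
      have hsmall : ∀ᶠ t : ℝ in 𝓝 0, ε * |t| < ρ / 2 := by
        have : Continuous fun t : ℝ => ε * |t| := by fun_prop
        exact (this.tendsto 0).eventually (gt_mem_nhds (by simpa using half_pos hρ))
      filter_upwards [hT, hl0.eventually h, hsmall,
        hl0.eventually (Metric.ball_mem_nhds p (half_pos hρ))] with t h1 h2 h3 h4
      rcases eq_or_ne t 0 with rfl | ht0
      · simp
      have h5 : Metric.infDist (p + t • w) M < ε * |t| := by
        have hle : Metric.infDist (p + t • w) M ≤ ε / 2 * |t| := by
          refine le_of_sq_le_sq ?_ (by positivity)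
          rw [mul_pow, sq_abs]
          have := (abs_le.1 h1).2
          nlinarith [sq_nonneg t]
        refine hle.trans_lt ?_
        have : 0 < |t| := abs_pos.2 ht0
        nlinarith
      obtain ⟨q, hqM, hq⟩ := (Metric.infDist_lt_iff ⟨p, hpM⟩).1 h5
      have hqball : q ∈ Metric.ball p ρ := by
        rw [Metric.mem_ball]
        have h4' : dist (p + t • w) p < ρ / 2 := h4
        linarith [dist_triangle_left q p (p + t • w)]
      have h6 := hK.norm_sub_le (hball (Metric.ball_subset_ball (half_le_self hρ.le) h4)).1
        (hball hqball).1
      rw [hG0 q (hball hqball).2 hqM, sub_zero, ← dist_eq_norm] at h6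
      have h7 : G (p + (0 : ℝ) • w) = 0 := by simpa using hG0 p hpΦ hpM
      rw [h7, sub_zero, sub_zero, Real.norm_eq_abs, mul_assoc]
      exact h6.trans (mul_le_mul_of_nonneg_left hq.le K.2)
    have hzero : ‖fderiv ℝ Φ p w - V.starProjection (fderiv ℝ Φ p w)‖ ≤ 0 := by
      refine le_of_forall_pos_le_add fun δ hδ => ?_
      refine (hbound (δ / (K + 1)) (by positivity)).trans ?_
      rw [zero_add, mul_div_assoc', div_le_iff₀ (by positivity)]
      nlinarith [K.2]
    rw [norm_le_zero_iff, sub_eq_zero] at hzero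
    exact Submodule.starProjection_eq_self_iff.1 hzero.symm
  · have hid : HasFDerivAt (fun x => Φ.symm (Φ x)) (ContinuousLinearMap.id ℝ (𝔼 n)) p := by
      refine (hasFDerivAt_id p).congr_of_eventuallyEq ?_
      filter_upwards [Φ.open_source.mem_nhds hpΦ] with x hx
      exact Φ.left_inv hx
    exact congrArg (fun L : 𝔼 n →L[ℝ] 𝔼 n => L w) ((hΨd.comp p hΦd).unique hid)

/-- On a free submanifold the Hessian of a defining function is positive on the polar cone. -/
theorem isPolarPos_fderiv_fderiv {P : ProperCone ℝ (SymForms n)} (hP : IsPositiveCone P)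
    (hM : IsClosedSubmanifold X M) (hfree : IsFreeSubmanifold P M) (hpM : p ∈ M)
    (hf : ContDiffAt ℝ 2 f p) (h : ∀ᶠ x in 𝓝 p, Metric.infDist x M ^ 2 ≤ f x) (h0 : f p = 0) :
    IsPolarPos P (fderiv ℝ (fderiv ℝ f) p) := by
  obtain ⟨Φ, V, hpΦ, hΦ⟩ := hM.exists_chart hpM
  refine isPolarPos_of_free hP (hfree p hpM) (fderiv_fderiv_nonneg_of_infDist_sq_le hf h h0) ?_
  intro w hw
  obtain ⟨u, hu, rfl⟩ := hΦ.exists_eq_fderiv_symm_of_fderiv_fderiv_le hpΦ hpM hf h h0 hw.le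
  exact hΦ.fderiv_symm_mem_tangentSubspace hpΦ hpM hu

/-- Uniform convexity of a defining function in the normal directions. In the chart, `w` is normal
to `M` at `q` exactly when `adjoint (DΨ (Φ q)) w` is orthogonal to `V`, where `Ψ = Φ.symm`; adding
the squared norm of the `V`-component gives a form that is positive definite at `p`, hence
nearby. -/
theorem IsFlatteningChart.eventually_forall_fderiv_fderiv_nonneg
    {Φ : OpenPartialHomeomorph (𝔼 n) (𝔼 n)} {V : Submodule ℝ (𝔼 n)}
    (hΦ : IsFlatteningChart M Φ V) (hpΦ : p ∈ Φ.source) (hpM : p ∈ M)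
    (hf : ContDiffAt ℝ 2 f p)
    (h : ∀ᶠ x in 𝓝 p, Metric.infDist x M ^ 2 ≤ f x) (h0 : f p = 0) :
    ∀ᶠ z : 𝔼 n × 𝔼 n in 𝓝 (p, p), ∀ w : 𝔼 n,
      (∀ u ∈ V, inner ℝ w (fderiv ℝ Φ.symm (Φ z.2) u) = 0) →
        0 ≤ fderiv ℝ (fderiv ℝ f) z.1 w w := by
  let A : 𝔼 n → 𝔼 n →L[ℝ] 𝔼 n := fun q => ContinuousLinearMap.adjoint (fderiv ℝ Φ.symm (Φ q))
  let Q : 𝔼 n × 𝔼 n → 𝔼 n → ℝ := fun z w =>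
    fderiv ℝ (fderiv ℝ f) z.1 w w + ‖V.starProjection (A z.2 w)‖ ^ 2
  have hAV : ∀ q w, (∀ u ∈ V, inner ℝ w (fderiv ℝ Φ.symm (Φ q) u) = 0) ↔
      V.starProjection (A q w) = 0 := by
    intro q w
    rw [Submodule.starProjection_apply_eq_zero_iff, Submodule.mem_orthogonal']
    simp only [A, ContinuousLinearMap.adjoint_inner_left]
  have hAc : ContinuousAt A p := by
    have h1 : ContinuousAt (fderiv ℝ Φ.symm) (Φ p) :=
      (((hΦ.contDiffAt_symm (Φ.map_source hpΦ)).of_le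
        (ENat.LEInfty.out : (1 : ℕ∞ω) ≤ ∞)).fderiv_right (m := 0) (zero_add 1).le).continuousAt
    have h2 : ContinuousAt (fun q => fderiv ℝ Φ.symm (Φ q)) p :=
      ContinuousAt.comp (g := fderiv ℝ Φ.symm) h1 (Φ.continuousAt hpΦ)
    exact (ContinuousLinearMap.adjoint (𝕜 := ℝ) (E := 𝔼 n)
      (F := 𝔼 n)).continuous.continuousAt.comp h2
  have htube : ∀ᶠ z in 𝓝 (p, p), ∀ w ∈ Metric.sphere (0 : 𝔼 n) 1, 0 < Q z w := by
    refine (isCompact_sphere (0 : 𝔼 n) 1).eventually_forall_of_forall_eventually fun w hw => ?_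
    have hpos : 0 < Q (p, p) w := by
      have hnn := fderiv_fderiv_nonneg_of_infDist_sq_le hf h h0 w
      by_contra! hneg
      have hle : fderiv ℝ (fderiv ℝ f) p w w ≤ 0 := by
        have := sq_nonneg ‖V.starProjection (A p w)‖
        simp only [Q] at hneg
        linarith
      have hz : V.starProjection (A p w) = 0 := by
        have : ‖V.starProjection (A p w)‖ ^ 2 ≤ 0 := by
          simp only [Q] at hneg
          linarith
        simpa using le_antisymm this (sq_nonneg _)
      obtain ⟨u, hu, hw'⟩ := hΦ.exists_eq_fderiv_symm_of_fderiv_fderiv_le hpΦ hpM hf h h0 hle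
      have := (hAV p w).2 hz u hu
      rw [hw', real_inner_self_eq_norm_sq, mem_sphere_zero_iff_norm.1 hw] at this
      norm_num at this
    have hQc : ContinuousAt (fun z : (𝔼 n × 𝔼 n) × 𝔼 n => Q z.1 z.2) ((p, p), w) := by
      have c1 : ContinuousAt (fun z : (𝔼 n × 𝔼 n) × 𝔼 n => fderiv ℝ (fderiv ℝ f) z.1.1)
          ((p, p), w) :=
        ContinuousAt.comp (g := fderiv ℝ (fderiv ℝ f)) hf.continuousAt_fderiv_fderiv
          (by fun_prop)
      have c2 : ContinuousAt (fun z : (𝔼 n × 𝔼 n) × 𝔼 n => A z.1.2) ((p, p), w) :=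
        ContinuousAt.comp (g := A) hAc (by fun_prop)
      have c3 : ContinuousAt (fun z : (𝔼 n × 𝔼 n) × 𝔼 n => z.2) ((p, p), w) := by fun_prop
      exact ((c1.clm_apply c3).clm_apply c3).add
        ((V.starProjection.continuous.continuousAt.comp (c2.clm_apply c3)).norm.pow 2)
    exact hQc.eventually (lt_mem_nhds hpos)
  filter_upwards [htube] with z hz w hw
  rcases eq_or_ne w 0 with rfl | hw0
  · simp
  have hn : 0 < ‖w‖ := norm_pos_iff.2 hw0
  have h1 := hz (‖w‖⁻¹ • w) (by simp [norm_smul, hn.ne'])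
  simp only [Q, map_smul, (hAV z.2 w).1 hw, smul_zero, norm_zero] at h1
  have h2 : 0 < ‖w‖⁻¹ := inv_pos.2 hn
  have h3 : 0 < ‖w‖⁻¹ * (‖w‖⁻¹ * fderiv ℝ (fderiv ℝ f) z.1 w w) := by simpa using! h1
  exact ((mul_pos_iff_of_pos_left h2).1 ((mul_pos_iff_of_pos_left h2).1 h3)).le

/-- Near `M`, a defining function is convex on the segment to the nearest point of `M`. -/
theorem IsClosedSubmanifold.eventually_forall_segment (hX : IsOpen X)
    (hM : IsClosedSubmanifold X M) (hf : ContDiffOn ℝ ∞ f X)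
    (h : ∀ x ∈ X, Metric.infDist x M ^ 2 ≤ f x) (h0 : ∀ x ∈ M, f x = 0) (hp : p ∈ M) :
    ∀ᶠ x in 𝓝 p, ∀ q, IsStrongNearestPoint M x q → ∀ t ∈ Icc (0 : ℝ) 1,
      x + t • (q - x) ∈ X ∧ f (x + t • (q - x)) ≤ (1 - t) * f x := by
  obtain ⟨Φ, V, hpΦ, hΦ⟩ := hM.exists_chart hp
  have hX' : X ∈ 𝓝 p := hX.mem_nhds (hM.subset hp)
  have hf2 : ∀ x ∈ X, ContDiffAt ℝ 2 f x := fun x hx =>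
    (hf.contDiffAt (hX.mem_nhds hx)).of_le ENat.LEInfty.out
  have hev := hΦ.eventually_forall_fderiv_fderiv_nonneg hpΦ hp (hf2 p (hM.subset hp))
    (by filter_upwards [hX'] with x hx using h x hx) (h0 p hp)
  obtain ⟨ρ, hρ, hball⟩ := Metric.eventually_nhds_iff_ball.1 hev
  obtain ⟨σ, hσ, hσball⟩ := Metric.mem_nhds_iff.1
    (inter_mem (inter_mem hX' (Φ.open_source.mem_nhds hpΦ)) (Metric.ball_mem_nhds p hρ))
  filter_upwards [Metric.ball_mem_nhds p (half_pos hσ)] with x hx q hq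
  have hxσ : x ∈ Metric.ball p σ := Metric.ball_subset_ball (half_le_self hσ.le) hx
  have hqσ : q ∈ Metric.ball p σ := by
    have h1 := hq.norm_sub_le hp
    rw [← dist_eq_norm, ← dist_eq_norm, dist_comm] at h1
    rw [Metric.mem_ball] at hx ⊢
    linarith [dist_triangle q x p]
  have hseg : ∀ t ∈ Icc (0 : ℝ) 1, x + t • (q - x) ∈ Metric.ball p σ := fun t ht =>
    (convex_ball p σ).add_smul_sub_mem hxσ hqσ ht
  have hnormal : ∀ u ∈ V, inner ℝ (q - x) (fderiv ℝ Φ.symm (Φ q) u) = 0 := by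
    intro u hu
    rw [← neg_sub x q, inner_neg_left, hΦ.inner_fderiv_symm_eq_zero (hσball hqσ).1.2 hq.1
      (.of_forall fun q' hq' => pow_le_pow_left₀ (norm_nonneg _) (hq.norm_sub_le hq') 2) hu,
      neg_zero]
  have hnn : ∀ t ∈ Icc (0 : ℝ) 1,
      0 ≤ fderiv ℝ (fderiv ℝ f) (x + t • (q - x)) (q - x) (q - x) := by
    intro t ht
    refine hball (x + t • (q - x), q) ?_ _ hnormal
    rw [Metric.mem_ball, Prod.dist_eq, max_lt_iff]
    exact ⟨(hσball (hseg t ht)).2, (hσball hqσ).2⟩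
  have hl : ∀ t : ℝ, HasDerivAt (fun t : ℝ => x + t • (q - x)) (q - x) t := fun t => by
    simpa using ((hasDerivAt_id t).smul_const (q - x)).const_add x
  have hd1 : ∀ t ∈ Icc (0 : ℝ) 1, HasDerivAt (fun t : ℝ => f (x + t • (q - x)))
      (fderiv ℝ f (x + t • (q - x)) (q - x)) t := fun t ht =>
    ((hf2 _ (hσball (hseg t ht)).1.1).differentiableAt two_ne_zero).hasFDerivAt.comp_hasDerivAt t
      (hl t)
  have hd2 : ∀ t ∈ Icc (0 : ℝ) 1,
      HasDerivAt (fun t : ℝ => fderiv ℝ f (x + t • (q - x)) (q - x))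
        (fderiv ℝ (fderiv ℝ f) (x + t • (q - x)) (q - x) (q - x)) t := fun t ht => by
    have h3 := (hf2 _ (hσball (hseg t ht)).1.1).differentiableAt_fderiv.hasFDerivAt.comp_hasDerivAt
      t (hl t)
    simpa using! h3.clm_apply (hasDerivAt_const t (q - x))
  have hconv : ConvexOn ℝ (Icc (0 : ℝ) 1) fun t : ℝ => f (x + t • (q - x)) := by
    refine convexOn_of_hasDerivWithinAt2_nonneg (convex_Icc 0 1)
      (fun t ht => (hd1 t ht).continuousAt.continuousWithinAt)
      (fun t ht => (hd1 t (interior_subset ht)).hasDerivWithinAt)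
      (fun t ht => (hd2 t (interior_subset ht)).hasDerivWithinAt)
      (fun t ht => hnn t (interior_subset ht))
  intro t ht
  refine ⟨(hσball (hseg t ht)).1.1, ?_⟩
  have := hconv.2 (left_mem_Icc.2 zero_le_one) (right_mem_Icc.2 zero_le_one)
    (sub_nonneg.2 ht.2) ht.1 (sub_add_cancel 1 t)
  simpa [h0 q hq.1] using this

end DefiningFunction

/-! ### Plurisubharmonic functions and hulls -/

section Plurisubharmonic

variable {n : ℕ}

local notation "𝔼" n:max => EuclideanSpace ℝ (Fin n)

variable {P : ProperCone ℝ (SymForms n)} {U : Set (𝔼 n)} {u : 𝔼 n → ℝ}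

theorem mem_PSHInfty_of_isPolarNonneg (hU : IsOpen U) (hu : ContDiffOn ℝ ∞ u U)
    (h : ∀ x ∈ U, IsPolarNonneg P (fderiv ℝ (fderiv ℝ u) x)) : u ∈ PSHInfty P U := by
  refine ⟨hu, fun x hx => (h x hx).formMatrix_mem ?_⟩
  have h2 : ContDiffAt ℝ 2 u x :=
    (hu.contDiffAt (hU.mem_nhds hx)).of_le ENat.LEInfty.out
  exact h2.isSymmSndFDerivAt (by simp)

theorem isStrictPSH_of_isPolarPos (hP : IsPositiveCone P) (hU : IsOpen U)
    (hu : ContDiffOn ℝ ∞ u U) (h : ∀ x ∈ U, IsPolarPos P (fderiv ℝ (fderiv ℝ u) x)) :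
    IsStrictPSH P U u := by
  refine ⟨hu, fun x hx => (h x hx).formMatrix_mem hP ?_⟩
  have h2 : ContDiffAt ℝ 2 u x :=
    (hu.contDiffAt (hU.mem_nhds hx)).of_le ENat.LEInfty.out
  exact h2.isSymmSndFDerivAt (by simp)

theorem IsStrictPSH.mem_PSHInfty (h : IsStrictPSH P U u) : u ∈ PSHInfty P U :=
  ⟨h.1, fun x hx => image_mono interior_subset (h.2 x hx)⟩

/-- The hull of a compact set is contained in a sublevel set of any plurisubharmonic exhaustion. -/
theorem isPConvex_of_exhaustion (hu : IsStrictPSH P U u)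
    (hc : ∀ c : ℝ, IsCompact {x ∈ U | u x ≤ c}) : IsPConvex P U := by
  refine ⟨fun K hK hKc => ?_, u, hu, hc⟩
  obtain ⟨c, hcK⟩ := hKc.bddAbove_image (hu.1.continuousOn.mono hK)
  exact ⟨_, sep_subset _ _, hc c, fun x hx =>
    ⟨hx.1, hx.2 u hu.mem_PSHInfty c fun y hy => hcK (mem_image_of_mem u hy)⟩⟩

theorem subset_pshHull {K : Set (𝔼 n)} (hK : K ⊆ U) : K ⊆ pshHull P U K :=
  fun x hx => ⟨hK hx, fun _ _ _ hc => hc x hx⟩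

end Plurisubharmonic

section Retract

variable {E : Type*} [TopologicalSpace E] {M U : Set E}

theorem IsDeformationRetract.isConnected (h : IsDeformationRetract M U) (hM : IsConnected M) :
    IsConnected U := by
  obtain ⟨hMU, H, hH, hHU, hH0, hH1, -⟩ := h
  obtain ⟨m, hm⟩ := hM.nonempty
  refine ⟨⟨m, hMU hm⟩, isPreconnected_of_forall m fun y hy => ?_⟩
  have hpath : IsPreconnected ((fun t : ℝ => H (t, y)) '' Icc 0 1) :=
    isPreconnected_Icc.image _ (hH.comp (by fun_prop) fun t ht => ⟨ht, hy⟩)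
  refine ⟨M ∪ (fun t : ℝ => H (t, y)) '' Icc 0 1, union_subset hMU ?_, Or.inl hm,
    Or.inr ⟨0, by simp, hH0 y hy⟩,
    hM.isPreconnected.union (H (1, y)) (hH1 y hy) ⟨1, by simp, rfl⟩ hpath⟩
  rintro _ ⟨t, ht, rfl⟩
  exact hHU ⟨ht, hy⟩

end Retract

/-! ### Neighborhoods `{f < η ^ 2}` of a free submanifold -/

section Neighborhoods

variable {n : ℕ}

local notation "𝔼" n:max => EuclideanSpace ℝ (Fin n)

variable {P : ProperCone ℝ (SymForms n)} {X M : Set (𝔼 n)}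

/-- A defining function `f` of `M` can be chosen so steep that `h + f` has positive Hessian on `M`
for a given smooth `h`: replace `f` by `λ f` with a large function `λ`. -/
theorem IsClosedSubmanifold.exists_defining_function (hP : IsPositiveCone P) (hX : IsOpen X)
    (hM : IsClosedSubmanifold X M) (hfree : IsFreeSubmanifold P M) {h : 𝔼 n → ℝ}
    (hh : ContDiffOn ℝ ∞ h X) :
    ∃ f : 𝔼 n → ℝ, ContDiffOn ℝ ∞ f X ∧ (∀ x ∈ X, Metric.infDist x M ^ 2 ≤ f x) ∧
      (∀ x ∈ M, f x = 0) ∧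
      ∀ x ∈ M, IsPolarPos P (fderiv ℝ (fderiv ℝ h) x + fderiv ℝ (fderiv ℝ f) x) := by
  obtain ⟨f, hf, hfd, hf0⟩ := hM.exists_sq_infDist_le hX
  have hf2 : ∀ x ∈ X, ContDiffAt ℝ 2 f x := fun x hx =>
    (hf.contDiffAt (hX.mem_nhds hx)).of_le ENat.LEInfty.out
  have hh2 : ∀ x ∈ X, ContDiffAt ℝ 2 h x := fun x hx =>
    (hh.contDiffAt (hX.mem_nhds hx)).of_le ENat.LEInfty.out
  have hconv : ∀ x ∈ X, Convex ℝ {c : ℝ | 1 ≤ c ∧ (x ∈ M →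
      IsPolarPos P (fderiv ℝ (fderiv ℝ h) x + c • fderiv ℝ (fderiv ℝ f) x))} := by
    intro x _ a ha b hb s t hs ht hst
    refine ⟨?_, fun hx => ?_⟩
    · have h1 : s * 1 + t * 1 ≤ s * a + t * b :=
        add_le_add (mul_le_mul_of_nonneg_left ha.1 hs) (mul_le_mul_of_nonneg_left hb.1 ht)
      rw [mul_one, mul_one, hst] at h1
      exact h1
    · intro A hA h0
      have h1 := ha.2 hx A hA h0
      have h2 := hb.2 hx A hA h0
      simp only [formPairing_add, formPairing_smul, smul_eq_mul] at h1 h2 ⊢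
      have h3 := convex_Ioi (𝕜 := ℝ) (0 : ℝ) h1 h2 hs ht hst
      simp only [mem_Ioi, smul_eq_mul] at h3
      refine h3.trans_eq ?_
      linear_combination formPairing A (fderiv ℝ (fderiv ℝ h) x) * hst
  obtain ⟨l, hl, hlX⟩ := exists_contDiffOn_forall_mem_convex hX hconv fun p hp => by
    by_cases hpM : p ∈ M
    · have hpos := isPolarPos_fderiv_fderiv hP hM hfree hpM (hf2 p hp)
        (by filter_upwards [hX.mem_nhds hp] with x hx using hfd x hx) (hf0 p hpM)
      have hcont : ContinuousAt (fun z : ℝ × 𝔼 n =>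
          z.1 • fderiv ℝ (fderiv ℝ h) z.2 + fderiv ℝ (fderiv ℝ f) z.2) (0, p) := by
        have c1 : ContinuousAt (fun z : ℝ × 𝔼 n => fderiv ℝ (fderiv ℝ h) z.2) (0, p) :=
          ContinuousAt.comp (g := fderiv ℝ (fderiv ℝ h)) (hh2 p hp).continuousAt_fderiv_fderiv
            (by fun_prop)
        have c2 : ContinuousAt (fun z : ℝ × 𝔼 n => fderiv ℝ (fderiv ℝ f) z.2) (0, p) :=
          ContinuousAt.comp (g := fderiv ℝ (fderiv ℝ f)) (hf2 p hp).continuousAt_fderiv_fderiv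
            (by fun_prop)
        exact (continuousAt_fst.smul c1).add c2
      have hev := hcont.eventually (IsPolarPos.eventually hP (by simpa using! hpos))
      rw [nhds_prod_eq] at hev
      obtain ⟨s, hs0, hs1, hs⟩ : ∃ s : ℝ, 0 < s ∧ s ≤ 1 ∧ ∀ᶠ x in 𝓝 p,
          IsPolarPos P (s • fderiv ℝ (fderiv ℝ h) x + fderiv ℝ (fderiv ℝ f) x) := by
        have h1 : ∀ᶠ s : ℝ in 𝓝[>] 0, s ≤ 1 :=
          mem_nhdsWithin_of_mem_nhds (Iic_mem_nhds one_pos)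
        obtain ⟨s, ⟨h2, h3⟩, h4⟩ := ((hev.curry.filter_mono nhdsWithin_le_nhds).and
          h1 |>.and self_mem_nhdsWithin).exists
        exact ⟨s, h4, h3, h2⟩
      refine ⟨fun _ => s⁻¹, _, hs, contDiffOn_const, fun x hx _ =>
        ⟨(one_le_inv₀ hs0).2 hs1, fun _ => ?_⟩⟩
      intro A hA h0
      have h1 := mul_pos (inv_pos.2 hs0) (hx A hA h0)
      rw [formPairing_add, formPairing_smul] at h1 ⊢
      rwa [mul_add, inv_mul_cancel_left₀ hs0.ne'] at h1
    · refine ⟨fun _ => 1, _,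
        isClosed_closure.isOpen_compl.mem_nhds fun h => hpM (hM.closed ⟨h, hp⟩), contDiffOn_const,
        fun x hx _ => ⟨le_rfl, fun hxM => absurd (subset_closure hxM) hx⟩⟩
  refine ⟨fun x => l x * f x, hl.mul hf, fun x hx => ?_, fun x hx => ?_, fun x hx => ?_⟩
  · exact (hfd x hx).trans
      (le_mul_of_one_le_left ((sq_nonneg _).trans (hfd x hx)) (hlX x hx).1)
  · simp [hf0 x hx]
  · have hxX := hM.subset hx
    have hl2 : ContDiffAt ℝ 2 l x :=
      (hl.contDiffAt (hX.mem_nhds hxX)).of_le ENat.LEInfty.out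
    have hd0 := fderiv_eq_zero_of_infDist_sq_le
      (by filter_upwards [hX.mem_nhds hxX] with y hy using hfd y hy) (hf0 x hx)
    have := (hlX x hxX).2 hx
    rw [fderiv_fderiv_mul hl2 (hf2 x hxX), hf0 x hx, hd0]
    convert! this using 2
    ext v w
    simp

/-- A smooth function `η`, positive on `X`, with slow variation, such that a property that holds
uniformly near each point of `M` for small parameters `s` holds on `{f < η ^ 2}` with a parameter
that bounds the derivatives of `η` up to order two. -/
theorem IsClosedSubmanifold.exists_radius (hX : IsOpen X)
    (hM : IsClosedSubmanifold X M) (hne : M.Nonempty) {f : 𝔼 n → ℝ} (hf : ContinuousOn f X)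
    (hfd : ∀ x ∈ X, Metric.infDist x M ^ 2 ≤ f x) {Q : 𝔼 n → ℝ → Prop}
    (hQ : ∀ p ∈ M, ∃ s > 0, ∀ᶠ x in 𝓝 p, ∀ s', 0 < s' → s' ≤ s → Q x s') :
    ∃ η : 𝔼 n → ℝ, ContDiff ℝ ∞ η ∧ (∀ x ∈ X, 0 < η x) ∧
      (∀ x y, |η x - η y| ≤ ‖x - y‖ / 2) ∧
      ∀ x ∈ X, f x < η x ^ 2 → ∃ s, 0 < s ∧ s ≤ 1 ∧ Q x s ∧ η x ≤ s ∧ ‖fderiv ℝ η x‖ ≤ s ∧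
        ‖fderiv ℝ (fderiv ℝ η) x‖ ≤ s := by
  obtain ⟨δ, hδ, hδX⟩ := exists_contDiffOn_pos_of_eventually hX
    (Q := fun x s => s ≤ 1 / 2 ∧ (f x < s ^ 2 → Q x s)) fun p hp => by
      by_cases hpM : p ∈ M
      · obtain ⟨s, hs, hev⟩ := hQ p hpM
        refine ⟨min s (1 / 2), lt_min hs one_half_pos, hev.mono fun x hx s' h0 hs' =>
          ⟨hs'.trans (min_le_right _ _), fun _ => hx s' h0 (hs'.trans (min_le_left _ _))⟩⟩
      · have hfp : 0 < f p := (pow_pos (hM.infDist_pos hne hp hpM) 2).trans_le (hfd p hp)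
        refine ⟨min (√(f p / 2)) (1 / 2), lt_min (by positivity) one_half_pos, ?_⟩
        filter_upwards [(hf.continuousAt (hX.mem_nhds hp)).eventually
          (lt_mem_nhds (half_lt_self hfp))] with x hx s' h0 hs'
        refine ⟨hs'.trans (min_le_right _ _), fun hlt => absurd hlt (not_lt.2 ?_)⟩
        have h1 := pow_le_pow_left₀ h0.le (hs'.trans (min_le_left _ _)) 2
        rw [Real.sq_sqrt (by positivity)] at h1
        exact h1.trans hx.le
  obtain ⟨η, hη, hη0, hηX⟩ := exists_contDiff_pos_le hX hδ.continuousOn fun x hx => (hδX x hx).1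
  refine ⟨η, hη, fun x hx => (hηX x hx).1, fun x y => ?_, fun x hx hlt => ?_⟩
  · have hb : ∀ z, ‖fderiv ℝ η z‖ ≤ 1 / 2 := by
      intro z
      by_cases hz : z ∈ X
      · exact (hηX z hz).2.2.1.trans (hδX z hz).2.1
      · -- `η` vanishes off `X`, so it has a minimum there.
        have : fderiv ℝ η z = 0 := by
          refine IsLocalMin.fderiv_eq_zero (.of_forall fun y => ?_)
          rw [hη0 z hz]
          by_cases hy : y ∈ X
          · exact (hηX y hy).1.le
          · exact (hη0 y hy).ge
        rw [this, norm_zero]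
        norm_num
    have := convex_univ.norm_image_sub_le_of_norm_fderiv_le (𝕜 := ℝ)
      (fun z _ => (hη.differentiable (by simp)) z) (fun z _ => hb z) (mem_univ y) (mem_univ x)
    rw [Real.norm_eq_abs] at this
    linarith
  · obtain ⟨h1, h2, h3, h4⟩ := hηX x hx
    refine ⟨δ x, (hδX x hx).1, (hδX x hx).2.1.trans (by norm_num), (hδX x hx).2.2 ?_, h2, h3, h4⟩
    exact hlt.trans_le (pow_le_pow_left₀ h1.le h2 2)

end Neighborhoods

/-! ### Fundamental systems of neighborhoods of a free submanifold -/

section Main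

variable {n : ℕ}

local notation "𝔼" n:max => EuclideanSpace ℝ (Fin n)

variable {P : ProperCone ℝ (SymForms n)} {X M U : Set (𝔼 n)} {f h η : 𝔼 n → ℝ}

/-- The Hessian of `1 / (η ^ 2 - f)` is nonnegative where `η` varies slowly compared with the
positivity of the Hessian of `f`, since `s ↦ -1 / s` is increasing and convex on `s < 0`. -/
theorem isPolarNonneg_fderiv_fderiv_inv (hP : IsPositiveCone P) {x : 𝔼 n} {s : ℝ}
    (hf : ContDiffAt ℝ 2 f x) (hη : ContDiffAt ℝ 2 η x) (hlt : f x < η x ^ 2) (hs : s ≤ 1)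
    (h0 : 0 < η x) (h1 : η x ≤ s) (h2 : ‖fderiv ℝ η x‖ ≤ s)
    (h3 : ‖fderiv ℝ (fderiv ℝ η) x‖ ≤ s)
    (hpos : ∀ C, ‖C‖ ≤ 4 * s → IsPolarPos P (fderiv ℝ (fderiv ℝ f) x + C)) :
    IsPolarNonneg P (fderiv ℝ (fderiv ℝ fun y => (η y * η y - f y)⁻¹) x) := by
  have hg : 0 < η x * η x - f x := by nlinarith
  have hηη : ContDiffAt ℝ 2 (fun y => η y * η y) x := hη.mul hη
  have hs0 : 0 ≤ s := h0.le.trans h1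
  rw [fderiv_fderiv_inv (hηη.sub hf) hg.ne']
  refine (IsPolarNonneg.smul ?_ (by positivity)).add
    ((isPolarNonneg_of_nonneg hP fun v => ?_).smul (by positivity))
  · have hC := (hpos (-fderiv ℝ (fderiv ℝ fun y => η y * η y) x) ?_).isPolarNonneg
    · rwa [fderiv_fderiv_sub hηη hf, neg_sub, sub_eq_add_neg]
    · have h1' : ‖η x‖ ≤ s := by rwa [Real.norm_of_nonneg h0.le]
      exact (norm_neg_fderiv_fderiv_mul_self_le hη h1' h2 h3).trans (by nlinarith)
  · simpa using mul_self_nonneg (fderiv ℝ (fun y => η y * η y - f y) x v)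

theorem isCompact_sublevel_inv_sub (hf : ContinuousOn f X) (hη : Continuous η)
    (hh : ContinuousOn h X) (hcomp : ∀ c : ℝ, IsCompact {x ∈ X | h x ≤ c})
    (hf0 : ∀ x ∈ X, 0 ≤ f x) (c : ℝ) :
    IsCompact {x ∈ {x ∈ X | f x < η x ^ 2} | h x + f x + (η x * η x - f x)⁻¹ ≤ c} := by
  have hL : {x ∈ X | h x ≤ c} ⊆ X := sep_subset _ _
  have hg : ContinuousOn (fun x => η x * η x - f x) {x ∈ X | h x ≤ c} :=
    (hη.mul hη).continuousOn.sub (hf.mono hL)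
  -- Multiplying by `η ^ 2 - f` turns the condition into one that is closed up to the boundary.
  have hset : {x ∈ {x ∈ X | f x < η x ^ 2} | h x + f x + (η x * η x - f x)⁻¹ ≤ c} =
      {x ∈ X | h x ≤ c} ∩ (fun x => (η x * η x - f x, (h x + f x - c) * (η x * η x - f x) + 1)) ⁻¹'
        (Ici 0 ×ˢ Iic 0) := by
    ext x
    constructor
    · rintro ⟨⟨hx, hlt⟩, hle⟩
      have hgx : 0 < η x * η x - f x := by nlinarith
      have hinv := inv_pos.2 hgx
      refine ⟨⟨hx, by linarith [hf0 x hx]⟩, hgx.le, ?_⟩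
      have := mul_le_mul_of_nonneg_right hle hgx.le
      rw [add_mul, inv_mul_cancel₀ hgx.ne'] at this
      change (h x + f x - c) * (η x * η x - f x) + 1 ≤ 0
      linarith
    · rintro ⟨⟨hx, -⟩, h1, h2⟩
      have h1' : 0 ≤ η x * η x - f x := h1
      have h2' : (h x + f x - c) * (η x * η x - f x) + 1 ≤ 0 := h2
      have hgx : 0 < η x * η x - f x := by
        refine h1'.lt_of_ne fun h0 => ?_
        rw [← h0] at h2'
        norm_num at h2'
      refine ⟨⟨hx, by rw [sq]; linarith⟩, ?_⟩
      have h3 : (η x * η x - f x)⁻¹ ≤ c - h x - f x := by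
        rw [inv_le_iff_one_le_mul₀ hgx]
        linarith
      linarith
  rw [hset]
  refine (hcomp c).of_isClosed_subset ?_ inter_subset_left
  refine ContinuousOn.preimage_isClosed_of_isClosed ?_ (hcomp c).isClosed
    (isClosed_Ici.prod isClosed_Iic)
  exact hg.prodMk (((((hh.mono hL).add (hf.mono hL)).sub continuousOn_const).mul hg).add
    continuousOn_const)

/-- Moving along the segments to the nearest points retracts `{f < η ^ 2}` to `M`: the function `f`
decreases at least linearly on these segments, and `η` varies slowly. -/
theorem isDeformationRetract_of_segment (hMX : M ⊆ X)
    (hfd : ∀ x ∈ X, Metric.infDist x M ^ 2 ≤ f x) (hf0 : ∀ x ∈ M, f x = 0)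
    (hη : ∀ x ∈ X, 0 < η x) (hηl : ∀ x y, |η x - η y| ≤ ‖x - y‖ / 2)
    (hnear : ∀ x ∈ X, f x < η x ^ 2 → ∃ q, IsStrongNearestPoint M x q)
    (hseg : ∀ x ∈ X, f x < η x ^ 2 → ∀ q, IsStrongNearestPoint M x q → ∀ t ∈ Icc (0 : ℝ) 1,
      x + t • (q - x) ∈ X ∧ f (x + t • (q - x)) ≤ (1 - t) * f x) :
    IsDeformationRetract M {x ∈ X | f x < η x ^ 2} := by
  have hMU : M ⊆ {x ∈ X | f x < η x ^ 2} := fun x hx =>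
    ⟨hMX hx, by rw [hf0 x hx]; exact pow_pos (hη x (hMX hx)) 2⟩
  have hex : ∀ x, ∃ q, x ∈ {x ∈ X | f x < η x ^ 2} → IsStrongNearestPoint M x q := fun x => by
    by_cases hx : x ∈ {x ∈ X | f x < η x ^ 2}
    · obtain ⟨q, hq⟩ := hnear x hx.1 hx.2
      exact ⟨q, fun _ => hq⟩
    · exact ⟨x, fun h => absurd h hx⟩
  choose r hr using hex
  have hrc : ContinuousOn r {x ∈ X | f x < η x ^ 2} :=
    continuousOn_of_isStrongNearestPoint hr
  refine ⟨hMU, fun z => z.2 + z.1 • (r z.2 - z.2), ?_, ?_, fun x _ => by simp,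
    fun x hx => by simpa using (hr x hx).1, fun t _ x hx => ?_⟩
  · have h1 : ContinuousOn (fun z : ℝ × 𝔼 n => r z.2)
        (Icc 0 1 ×ˢ {x ∈ X | f x < η x ^ 2}) :=
      hrc.comp continuousOn_snd fun z hz => hz.2
    exact continuousOn_snd.add (continuousOn_fst.smul (h1.sub continuousOn_snd))
  · rintro ⟨t, x⟩ ⟨ht, hx⟩
    obtain ⟨h1, h2⟩ := hseg x hx.1 hx.2 (r x) (hr x hx) t ht
    refine ⟨h1, ?_⟩
    change f (x + t • (r x - x)) < η (x + t • (r x - x)) ^ 2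
    have ht0 : (0 : ℝ) ≤ t := ht.1
    have ht1 : t ≤ 1 := ht.2
    have hlt : f x < η x ^ 2 := hx.2
    have hηx := hη x hx.1
    have h3 : ‖x - r x‖ ≤ η x := by
      refine ((hr x hx).norm_sub_le_infDist).trans (le_of_sq_le_sq ?_ hηx.le)
      exact (hfd x hx.1).trans hlt.le
    have h4 := (abs_le.1 (hηl x (x + t • (r x - x)))).2
    rw [sub_add_cancel_left, norm_neg, norm_smul, Real.norm_of_nonneg ht0, norm_sub_rev] at h4
    have h5 : (1 - t / 2) * η x ≤ η (x + t • (r x - x)) := by nlinarith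
    have h6 : ((1 - t / 2) * η x) ^ 2 ≤ η (x + t • (r x - x)) ^ 2 :=
      pow_le_pow_left₀ (mul_nonneg (by linarith) hηx.le) h5 2
    rcases ht1.eq_or_lt with rfl | ht1
    · have := hη _ h1
      nlinarith
    · nlinarith [mul_lt_mul_of_pos_left hlt (sub_pos.2 ht1), sq_nonneg (t * η x)]
  · have : r x = x := (hr x (hMU hx)).eq_of_mem hx
    simp [this]

/-- Compact subsets of the zero set `M` of a strictly plurisubharmonic function `f ≥ 0` are equal to
their hulls: a small multiple of a bump function can be added to `f`. -/
theorem pshHull_eq_of_subset (hP : IsPositiveCone P) (hU : IsOpen U) (hf : ContDiffOn ℝ ∞ f U)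
    (hpos : ∀ x ∈ U, IsPolarPos P (fderiv ℝ (fderiv ℝ f) x)) (hMU : M ⊆ U)
    (hM : ∀ x ∈ U, f x ≤ 0 → x ∈ M) (hf0 : ∀ x ∈ M, f x = 0) {K : Set (𝔼 n)} (hKM : K ⊆ M)
    (hK : IsCompact K) : pshHull P U K = K := by
  refine subset_antisymm (fun x hx => ?_) (subset_pshHull (hKM.trans hMU))
  have hf2 : ∀ x ∈ U, ContDiffAt ℝ 2 f x := fun x hx =>
    (hf.contDiffAt (hU.mem_nhds hx)).of_le ENat.LEInfty.out
  have hxM : x ∈ M := hM x hx.1 (hx.2 f (mem_PSHInfty_of_isPolarNonneg hU hf fun y hy =>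
    (hpos y hy).isPolarNonneg) 0 fun y hy => (hf0 y (hKM hy)).le)
  by_contra hxK
  obtain ⟨g, hgs, hgc, hg, -, hgx⟩ := exists_contDiff_tsupport_subset (n := ⊤)
    ((hU.sdiff hK.isClosed).mem_nhds ⟨hx.1, hxK⟩)
  have hg2 : ContDiff ℝ 2 g := hg.of_le ENat.LEInfty.out
  have hev : ∀ᶠ s : ℝ in 𝓝 0, ∀ y ∈ tsupport g,
      IsPolarPos P (s • fderiv ℝ (fderiv ℝ g) y + fderiv ℝ (fderiv ℝ f) y) := by
    refine hgc.isCompact.eventually_forall_of_forall_eventually fun y hy => ?_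
    have c1 : ContinuousAt (fun z : ℝ × 𝔼 n => fderiv ℝ (fderiv ℝ g) z.2) (0, y) :=
      ContinuousAt.comp (g := fderiv ℝ (fderiv ℝ g)) hg2.contDiffAt.continuousAt_fderiv_fderiv
        (by fun_prop)
    have c2 : ContinuousAt (fun z : ℝ × 𝔼 n => fderiv ℝ (fderiv ℝ f) z.2) (0, y) :=
      ContinuousAt.comp (g := fderiv ℝ (fderiv ℝ f))
        (hf2 y (hgs hy).1).continuousAt_fderiv_fderiv (by fun_prop)
    exact ((continuousAt_fst.smul c1).add c2).eventually
      (IsPolarPos.eventually hP (by simpa using! hpos y (hgs hy).1))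
  obtain ⟨s, hs, hs0⟩ := ((hev.filter_mono nhdsWithin_le_nhds).and
    (self_mem_nhdsWithin (a := (0 : ℝ)) (s := Ioi 0))).exists
  have hsg : ContDiff ℝ ∞ fun y => s * g y := contDiff_const.mul hg
  have hu : (fun y => s * g y + f y) ∈ PSHInfty P U := by
    refine mem_PSHInfty_of_isPolarNonneg hU (hsg.contDiffOn.add hf) fun y hy => ?_
    rw [fderiv_fderiv_add (hsg.contDiffAt.of_le ENat.LEInfty.out) (hf2 y hy),
      fderiv_fderiv_const_mul hg2.contDiffAt]
    by_cases hyg : y ∈ tsupport g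
    · exact (hs y hyg).isPolarNonneg
    · have h0 : g =ᶠ[𝓝 y] fun _ => 0 := notMem_tsupport_iff_eventuallyEq.1 hyg
      have h1 : fderiv ℝ (fderiv ℝ g) y = 0 := by
        rw [h0.fderiv.fderiv_eq]
        simp
      rw [h1]
      simpa using! (hpos y hy).isPolarNonneg
  have := hx.2 _ hu 0 fun y hy => by
    have : g y = 0 := image_eq_zero_of_notMem_tsupport fun h => (hgs h).2 hy
    simp [this, hf0 y (hKM hy)]
  simp only [hgx, hf0 x hxM, mul_one, add_zero] at this
  exact absurd hs0 (not_lt.2 this)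

/-- Arbitrarily small neighborhoods of a nonempty free submanifold with the required properties. -/
theorem exists_nhd_of_isFreeSubmanifold (hP : IsPositiveCone P) (hX : IsOpen X)
    (hM : IsClosedSubmanifold X M) (hfree : IsFreeSubmanifold P M) (hne : M.Nonempty)
    {V : Set (𝔼 n)} (hV : IsOpen V) (hMV : M ⊆ V) :
    ∃ U, IsOpen U ∧ M ⊆ U ∧ U ⊆ X ∧ U ⊆ V ∧ IsPConvex P U ∧ IsDeformationRetract M U ∧
      ∀ K ⊆ M, IsCompact K → pshHull P U K = K := by
  obtain ⟨h, hh, -, hcomp⟩ := exists_smooth_exhaustion hX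
  obtain ⟨f, hf, hfd, hf0, hhf⟩ := hM.exists_defining_function hP hX hfree hh
  have hf2 : ∀ x ∈ X, ContDiffAt ℝ 2 f x := fun x hx =>
    (hf.contDiffAt (hX.mem_nhds hx)).of_le ENat.LEInfty.out
  have hh2 : ∀ x ∈ X, ContDiffAt ℝ 2 h x := fun x hx =>
    (hh.contDiffAt (hX.mem_nhds hx)).of_le ENat.LEInfty.out
  have hfnn : ∀ x ∈ X, 0 ≤ f x := fun x hx => (sq_nonneg _).trans (hfd x hx)
  obtain ⟨η, hη, hη0, hηl, hηQ⟩ := hM.exists_radius hX hne hf.continuousOn hfd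
    (Q := fun x s => x ∈ V ∧ (∃ q, IsStrongNearestPoint M x q) ∧
      (∀ q, IsStrongNearestPoint M x q → ∀ t ∈ Icc (0 : ℝ) 1,
        x + t • (q - x) ∈ X ∧ f (x + t • (q - x)) ≤ (1 - t) * f x) ∧
      IsPolarPos P (fderiv ℝ (fderiv ℝ h) x + fderiv ℝ (fderiv ℝ f) x) ∧
      ∀ C, ‖C‖ ≤ 4 * s → IsPolarPos P (fderiv ℝ (fderiv ℝ f) x + C)) fun p hp => by
    have hpX := hM.subset hp
    have c1 : ContinuousAt (fun x => fderiv ℝ (fderiv ℝ h) x + fderiv ℝ (fderiv ℝ f) x) p :=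
      (hh2 p hpX).continuousAt_fderiv_fderiv.add (hf2 p hpX).continuousAt_fderiv_fderiv
    have c2 : ContinuousAt (fun z : 𝔼 n × (𝔼 n →L[ℝ] 𝔼 n →L[ℝ] ℝ) =>
        fderiv ℝ (fderiv ℝ f) z.1 + z.2) (p, 0) := by
      have : ContinuousAt (fun z : 𝔼 n × (𝔼 n →L[ℝ] 𝔼 n →L[ℝ] ℝ) =>
          fderiv ℝ (fderiv ℝ f) z.1) (p, 0) :=
        ContinuousAt.comp (g := fderiv ℝ (fderiv ℝ f))
          (hf2 p hpX).continuousAt_fderiv_fderiv (by fun_prop)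
      exact this.add continuousAt_snd
    have hpos := isPolarPos_fderiv_fderiv hP hM hfree hp (hf2 p hpX)
      (by filter_upwards [hX.mem_nhds hpX] with x hx using hfd x hx) (hf0 p hp)
    have hev := c2.eventually (IsPolarPos.eventually hP (by simpa using! hpos))
    obtain ⟨ε, hε, hε'⟩ := exists_eventually_forall_norm_le (F := 𝔼 n →L[ℝ] 𝔼 n →L[ℝ] ℝ)
      (R := fun z => IsPolarPos P (fderiv ℝ (fderiv ℝ f) z.1 + z.2)) hev
    refine ⟨ε / 4, by positivity, ?_⟩
    filter_upwards [hV.mem_nhds (hMV hp), hM.eventually_exists_isStrongNearestPoint hX hp,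
      hM.eventually_forall_segment hX hf hfd hf0 hp,
      c1.eventually (IsPolarPos.eventually hP (hhf p hp)), hε']
      with x h1 h2 h3 h4 h5 s hs0 hs
    exact ⟨h1, h2, h3, h4, fun C hC => h5 C (hC.trans (by linarith))⟩
  have hη2 : ∀ x, ContDiffAt ℝ 2 η x := fun x => hη.contDiffAt.of_le ENat.LEInfty.out
  have hUX : {x ∈ X | f x < η x ^ 2} ⊆ X := sep_subset _ _
  have hU : IsOpen {x ∈ X | f x < η x ^ 2} := by
    have := (hf.continuousOn.sub (hη.continuous.pow 2).continuousOn).isOpen_inter_preimage hX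
      (isOpen_Iio (a := (0 : ℝ)))
    convert! this using 1
    ext x
    simp
  have hMU : M ⊆ {x ∈ X | f x < η x ^ 2} := fun x hx =>
    ⟨hM.subset hx, by rw [hf0 x hx]; exact pow_pos (hη0 x (hM.subset hx)) 2⟩
  have hposU : ∀ x ∈ {x ∈ X | f x < η x ^ 2}, IsPolarPos P (fderiv ℝ (fderiv ℝ f) x) := by
    intro x hx
    obtain ⟨s, hs0, -, hQ, -⟩ := hηQ x hx.1 hx.2
    simpa using! hQ.2.2.2.2 0 (ContinuousLinearMap.opNorm_zero.le.trans (by positivity))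
  refine ⟨_, hU, hMU, hUX, fun x hx => ?_, ?_, ?_, fun K hKM hK => ?_⟩
  · obtain ⟨s, -, -, hQ, -⟩ := hηQ x hx.1 hx.2
    exact hQ.1
  · have hsm : ContDiffOn ℝ ∞ (fun x => (η x * η x - f x)⁻¹) {x ∈ X | f x < η x ^ 2} :=
      ((hη.mul hη).contDiffOn.sub (hf.mono hUX)).inv fun x hx => by
        have : f x < η x ^ 2 := hx.2
        nlinarith
    have hhfU : ContDiffOn ℝ ∞ (fun x => h x + f x) {x ∈ X | f x < η x ^ 2} :=
      (hh.add hf).mono hUX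
    refine isPConvex_of_exhaustion (u := fun x => h x + f x + (η x * η x - f x)⁻¹)
      (isStrictPSH_of_isPolarPos hP hU (hhfU.add hsm) fun x hx => ?_)
      (isCompact_sublevel_inv_sub hf.continuousOn hη.continuous hh.continuousOn hcomp hfnn)
    obtain ⟨s, hs0, hs1, hQ, h1, h2, h3⟩ := hηQ x hx.1 hx.2
    rw [fderiv_fderiv_add (u := fun x => h x + f x)
      ((hhfU.contDiffAt (hU.mem_nhds hx)).of_le ENat.LEInfty.out)
      ((hsm.contDiffAt (hU.mem_nhds hx)).of_le ENat.LEInfty.out),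
      fderiv_fderiv_add (hh2 x hx.1) (hf2 x hx.1)]
    exact hQ.2.2.2.1.add_nonneg (isPolarNonneg_fderiv_fderiv_inv hP (hf2 x hx.1) (hη2 x) hx.2 hs1
      (hη0 x hx.1) h1 h2 h3 hQ.2.2.2.2)
  · refine isDeformationRetract_of_segment hM.subset hfd hf0 hη0 hηl (fun x hx hlt => ?_)
      fun x hx hlt => ?_
    · obtain ⟨s, -, -, hQ, -⟩ := hηQ x hx hlt
      exact hQ.2.1
    · obtain ⟨s, -, -, hQ, -⟩ := hηQ x hx hlt
      exact hQ.2.2.1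
  · refine pshHull_eq_of_subset hP hU (hf.mono hUX) hposU hMU (fun x hx hle => ?_) hf0 hKM hK
    by_contra hxM
    have := pow_pos (hM.infDist_pos hne hx.1 hxM) 2
    linarith [hfd x hx.1]

end Main

theorem theorem11p4 {n : ℕ} (P : ProperCone ℝ (SymForms n)) (hP : IsPositiveCone P)
    (X M : Set (EuclideanSpace ℝ (Fin n))) (hX : IsOpen X)
    (hM : IsClosedSubmanifold X M) (hfree : IsFreeSubmanifold P M) :
    ∃ F : Set (Set (EuclideanSpace ℝ (Fin n))),
      IsFundamentalNhdSystem X M F ∧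
      ∀ U ∈ F,
        (IsConnected M → IsConnected U) ∧
        IsPConvex P U ∧
        IsDeformationRetract M U ∧
        ∀ K ⊆ M, IsCompact K → pshHull P U K = K := by
  refine ⟨{U | IsOpen U ∧ M ⊆ U ∧ U ⊆ X ∧ IsPConvex P U ∧ IsDeformationRetract M U ∧
    ∀ K ⊆ M, IsCompact K → pshHull P U K = K},
    ⟨fun U hU => hU.1, fun U hU => ⟨hU.2.1, hU.2.2.1⟩, fun V hV hMV => ?_⟩,
    fun U hU => ⟨hU.2.2.2.2.1.isConnected, hU.2.2.2⟩⟩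
  rcases M.eq_empty_or_nonempty with rfl | hne
  · refine ⟨∅, ⟨isOpen_empty, subset_rfl, empty_subset _, ?_, ?_, fun K hK _ => ?_⟩,
      empty_subset _⟩
    · exact isPConvex_of_exhaustion (u := fun _ => 0)
        ⟨contDiffOn_const, fun x hx => hx.elim⟩ fun c => by simp
    · exact ⟨subset_rfl, fun z => z.2, by simp, fun z hz => hz.2.elim, fun x hx => hx.elim,
        fun x hx => hx.elim, fun t _ x hx => hx.elim⟩
    · rw [subset_empty_iff.1 hK]
      exact subset_empty_iff.1 fun x hx => hx.1
  · obtain ⟨U, h1, h2, h3, h4, h5⟩ := exists_nhd_of_isFreeSubmanifold hP hX hM hfree hne hV hMV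
    exact ⟨U, ⟨h1, h2, h3, h5⟩, h4⟩
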